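/- Let $a_1\le a_2\le\cdots$ be real numbers with $a_n\to\infty$, let $C\in\mathbb R$ and $\alpha>0$, and write $v_k=1/k$. For integers $n,m\ge 1$ let $$\Theta=\Theta_n(C)=\Big\{\theta\in\mathbb R^n:\ \sum_{i=1}^n a_i^2\theta_i^2\le C\Big\}.$$ For $\theta\in\mathbb R^n$ let $X\sim N(\theta,v_nI_n)$ and $\tilde X\sim N(\theta,v_mI_n)$ be independent. A predictive density is a non-negative measurable function $\hat p(\tilde x\mid x)$ on $\mathbb R^n\times\mathbb R^n$ with $\int\hat p(\tilde x\mid x)\,d\tilde x=1$ for every $x$. Its Kullback–Leibler risk is $$R(\theta,\hat p)=\frac1m\,E_{X,\tilde X\mid\theta}\log\frac{p(\tilde X\mid\theta)}{\hat p(\tilde X\mid X)}\in[0,\infty],$$ where $p(\cdot\mid\theta)$ is the density of $\tilde X$, and the minimax risk is $R(\Theta)=\inf_{\hat p}\sup_{\theta\in\Theta}R(\theta,\hat p)$, the infimum being over all predictive densities. Then there is a constant $K$, depending only on $(a_i)$, $C$ and $\alpha$, such that for all $n,m\ge1$ and all real $s_1,\dots,s_n$ (which may depend on $n$ and $m$)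 with $$\sum_{i=1}^n a_i^2s_i^2+\Big[-8\alpha\Big(\sum_{i=1}^n a_i^4s_i^4\Big)\log v_n\Big]^{1/2}\le C,$$ one has $$R(\Theta)\ \ge\ \frac{n}{2m}\log\frac{v_n}{v_{n+m}}+\frac1{2m}\sum_{i=1}^n\log\frac{v_{n+m}+s_i^2}{v_n+s_i^2}-K\,v_n^{\alpha}.$$ -/

import Mathlib

open MeasureTheory ProbabilityTheory InformationTheory Filter
open scoped NNReal ENNReal

/-- The variance `v_k = 1 / k`. -/
noncomputable def noiseVar (k : ℕ) : ℝ≥0 := 1 / (k : ℝ≥0)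

/-- The law `N(θ, v I_n)` on `ℝⁿ`. -/
noncomputable def gaussianVec {n : ℕ} (θ : Fin n → ℝ) (v : ℝ≥0) : Measure (Fin n → ℝ) :=
  Measure.pi fun i => gaussianReal (θ i) v

/-- A predictive density `(x, y) ↦ p̂(y | x)` on `ℝⁿ`: jointly measurable, non-negative, and for
every observed `x` of integral one in `y` with respect to Lebesgue measure. -/
structure PredictiveDensity (n : ℕ) where
  /-- The value `p̂(y | x)`, with the observation `x` as first argument. -/
  dens : (Fin n → ℝ) → (Fin n → ℝ) → ℝ
  measurable_dens : Measurable (Function.uncurry dens)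
  dens_nonneg : ∀ x y, 0 ≤ dens x y
  lintegral_dens : ∀ x, ∫⁻ y, ENNReal.ofReal (dens x y) = 1

/-- The predictive distribution `p̂(y | x) dy` given the observation `x`. -/
noncomputable def PredictiveDensity.law {n : ℕ} (p : PredictiveDensity n) (x : Fin n → ℝ) :
    Measure (Fin n → ℝ) :=
  volume.withDensity fun y => ENNReal.ofReal (p.dens x y)

/-- The Kullback-Leibler risk `R(θ, p̂) = (1/m) E log (p(X' | θ) / p̂(X' | X))`, where
`X ~ N(θ, v_n I_n)` and `X' ~ N(θ, v_m I_n)` are independent: the mean over `X` of the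
Kullback-Leibler divergence of `p̂(· | X)` from the law of `X'`, divided by `m`.
It takes values in `[0, ∞]`. -/
noncomputable def klRisk {n : ℕ} (m : ℕ) (θ : Fin n → ℝ) (p : PredictiveDensity n) : ℝ≥0∞ :=
  (m : ℝ≥0∞)⁻¹ *
    ∫⁻ x, klDiv (gaussianVec θ (noiseVar m)) (p.law x) ∂(gaussianVec θ (noiseVar n))

/-- The ellipsoid `∑ a_i² θ_i² ≤ C` in `ℝⁿ`; indices start at `0`, so `a_1` is `a 0`. -/
def ellipsoid (a : ℕ → ℝ) (C : ℝ) (n : ℕ) : Set (Fin n → ℝ) :=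
  {θ | ∑ i : Fin n, a i ^ 2 * θ i ^ 2 ≤ C}

/-- The minimax risk `R(Θ) = inf_p̂ sup_{θ ∈ Θ} R(θ, p̂)` over all predictive densities. -/
noncomputable def klMinimaxRisk {n : ℕ} (m : ℕ) (Θ : Set (Fin n → ℝ)) : ℝ≥0∞ :=
  ⨅ p : PredictiveDensity n, ⨆ θ ∈ Θ, klRisk m θ p

/-!
The maximal risk over the ellipsoid is at least the Bayes risk of any prior carried by it, and the
proof exhibits a prior for which the Bayes risk is at least the main term, without error term.

*Bayes risk.* For the prior law of a bounded random vector `θ`, let `G(v)` (`meanLog`) be the mean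
of `log q_v(X)`, where `X = θ + √v Z` with an independent standard Gaussian vector `Z`, and `q_v` is
the density of `X`. The mean risk of every predictive density is at least `m⁻¹ ((n / 2) log (w / u)
+ G(w) - G(u))`, with `w = v_n` and `u = v_{n+m}` (`ofReal_le_lintegral_klDiv`): the best predictive
density is the posterior predictive one, and the pair of independent observations with variances `w`
and `v_m` has the sufficient statistic of variance `u`.

*Entropy and estimation.* The growth of `G` as the noise level decreases is controlled by the
mean squared error of the posterior mean, `bayesMSE` (`meanLog_sub_meanLog_le`). If that error is at
least the linear one, `∑ v sᵢ² / (v + sᵢ²)`, for every noise level `v`, then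
`G(u) - G(w) ≤ ½ ∑ log ((w + sᵢ²) / (u + sᵢ²))`, which is what the main term asks for.

*Van Trees' inequality.* The error bound holds for `θ = s φ` as soon as every coordinate of `φ` has
Fisher information at most one (`IsUnitFisherDensity.le_bayesMSE`). For the standard Gaussian law
this is an equality, but that law is not carried by the ellipsoid.

*The prior.* With `bᵢ = aᵢ² sᵢ²`, the constraint on `φ` is `∑ bᵢ φᵢ² ≤ C`, and the slack
`C - ∑ bᵢ` is at least `(8 α log n)^{1/2} (∑ bᵢ²)^{1/2}`. For large `n` this is more than any given
multiple of `(∑ bᵢ²)^{1/2}`. The Gaussian density with slightly enlarged variances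
`1 + bᵢ / (∑ bⱼ²)^{1/2}`, times the squared cutoff `(C - ∑ bᵢ φᵢ²)₊²`, is then carried by the
ellipsoid, and the information lost by enlarging the variances pays for the information of the
cutoff (`exists_isUnitFisherDensity`). The remaining small `n` are absorbed in the constant: the
main term never exceeds `1 / 2`.
-/

/-! ### Gaussian vectors -/

instance isProbabilityMeasure_gaussianVec {n : ℕ} (θ : Fin n → ℝ) (v : ℝ≥0) :
    IsProbabilityMeasure (gaussianVec θ v) := by
  unfold gaussianVec; infer_instance

/-- The squared Euclidean norm on `ℝⁿ` (the norm of `Fin n → ℝ` being the sup norm). -/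
def normSq {n : ℕ} (x : Fin n → ℝ) : ℝ := ∑ i, x i ^ 2

@[fun_prop]
lemma continuous_normSq {n : ℕ} : Continuous (normSq (n := n)) := by
  unfold normSq; fun_prop

@[fun_prop]
lemma measurable_normSq {n : ℕ} : Measurable (normSq (n := n)) := continuous_normSq.measurable

lemma normSq_nonneg {n : ℕ} (x : Fin n → ℝ) : 0 ≤ normSq x :=
  Finset.sum_nonneg fun _ _ => sq_nonneg _

lemma normSq_smul {n : ℕ} (c : ℝ) (x : Fin n → ℝ) : normSq (c • x) = c ^ 2 * normSq x := by
  simp [normSq, Finset.mul_sum, mul_pow]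

lemma normSq_le {n : ℕ} (x : Fin n → ℝ) : normSq x ≤ n * ‖x‖ ^ 2 := by
  calc normSq x ≤ ∑ _i : Fin n, ‖x‖ ^ 2 := by
        refine Finset.sum_le_sum fun i _ => ?_
        rw [← sq_abs]
        exact pow_le_pow_left₀ (abs_nonneg _) (norm_le_pi_norm x i) 2
    _ = n * ‖x‖ ^ 2 := by simp

/-- The density of `N(0, v Iₙ)`. -/
noncomputable def gaussDens {n : ℕ} (v : ℝ) (x : Fin n → ℝ) : ℝ :=
  (√(2 * Real.pi * v))⁻¹ ^ n * Real.exp (-normSq x / (2 * v))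

@[fun_prop]
lemma continuous_gaussDens {n : ℕ} (v : ℝ) : Continuous (gaussDens (n := n) v) := by
  unfold gaussDens; fun_prop

@[fun_prop]
lemma measurable_gaussDens {n : ℕ} (v : ℝ) : Measurable (gaussDens (n := n) v) :=
  (continuous_gaussDens v).measurable

lemma gaussDens_pos {n : ℕ} {v : ℝ} (hv : 0 < v) (x : Fin n → ℝ) : 0 < gaussDens v x := by
  unfold gaussDens; positivity

lemma prod_gaussianPDFReal {n : ℕ} (θ : Fin n → ℝ) (v : ℝ≥0) (x : Fin n → ℝ) :
    ∏ i, gaussianPDFReal (θ i) v (x i) = gaussDens v (x - θ) := by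
  simp only [gaussianPDFReal, gaussDens, Finset.prod_mul_distrib, Finset.prod_const,
    Finset.card_univ, Fintype.card_fin, ← Real.exp_sum, normSq, Pi.sub_apply]
  rw [← Finset.sum_div, Finset.sum_neg_distrib]

lemma pi_gaussianReal_eq_withDensity {n : ℕ} (θ : Fin n → ℝ) (v : Fin n → ℝ≥0)
    (hv : ∀ i, v i ≠ 0) :
    Measure.pi (fun i => gaussianReal (θ i) (v i)) =
      volume.withDensity fun x => ENNReal.ofReal (∏ i, gaussianPDFReal (θ i) (v i) (x i)) := by
  refine Measure.pi_eq fun s hs => ?_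
  have hint : Integrable (fun x : Fin n → ℝ => ∏ i, gaussianPDFReal (θ i) (v i) (x i)) :=
    Integrable.fintype_prod fun i => integrable_gaussianPDFReal _ _
  rw [withDensity_apply _ (MeasurableSet.univ_pi hs),
    ← ofReal_integral_eq_lintegral_ofReal hint.integrableOn
      (ae_of_all _ fun x => Finset.prod_nonneg fun i _ => gaussianPDFReal_nonneg _ _ _),
    volume_pi, Measure.restrict_pi_pi,
    integral_fintype_prod_eq_prod (fun i x => gaussianPDFReal (θ i) (v i) x),
    ENNReal.ofReal_prod_of_nonneg
      (fun i _ => integral_nonneg fun x => gaussianPDFReal_nonneg _ _ _)]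
  refine Finset.prod_congr rfl fun i _ => ?_
  rw [gaussianReal_apply_eq_integral _ (hv i)]

lemma gaussianVec_eq_withDensity {n : ℕ} (θ : Fin n → ℝ) {v : ℝ≥0} (hv : v ≠ 0) :
    gaussianVec θ v = volume.withDensity fun x => ENNReal.ofReal (gaussDens v (x - θ)) := by
  rw [gaussianVec, pi_gaussianReal_eq_withDensity θ (fun _ => v) (fun _ => hv)]
  simp_rw [prod_gaussianPDFReal]

/-- The standard Gaussian measure on `ℝⁿ`. -/
noncomputable abbrev stdGauss (n : ℕ) : Measure (Fin n → ℝ) := gaussianVec 0 1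

lemma stdGauss_eq (n : ℕ) : stdGauss n = Measure.pi fun _ => gaussianReal 0 1 := rfl

lemma gaussianVec_eq_map {n : ℕ} (θ : Fin n → ℝ) (v : ℝ≥0) :
    gaussianVec θ v = (stdGauss n).map fun z => θ + √v • z := by
  have h : (fun z : Fin n → ℝ => θ + √v • z) = fun z i => (fun t : ℝ => θ i + √v * t) (z i) := by
    ext z i; simp
  have h1 (i : Fin n) : (gaussianReal 0 1).map (fun t : ℝ => θ i + √v * t)
      = gaussianReal (θ i) v := by
    rw [show (fun t : ℝ => θ i + √v * t) = (fun t => θ i + t) ∘ (fun t => √v * t) from rfl,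
      ← Measure.map_map (by fun_prop) (by fun_prop), gaussianReal_map_const_mul,
      gaussianReal_map_const_add]
    congr 1
    · simp
    · ext; simp
  have hσ (i : Fin n) : SigmaFinite ((gaussianReal 0 1).map (fun t : ℝ => θ i + √v * t)) := by
    rw [h1]; infer_instance
  rw [h, stdGauss_eq, Measure.pi_map_pi (μ := fun _ => gaussianReal 0 1)
    (f := fun i (t : ℝ) => θ i + √v * t) (fun i => by fun_prop)]
  simp only [h1, gaussianVec]

/-- Sums of independent centred Gaussian vectors are Gaussian, the variances adding up. -/
lemma map_smul_add_smul_stdGauss {n : ℕ} {a b c : ℝ} (h : a ^ 2 + b ^ 2 = c ^ 2) :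
    ((stdGauss n).prod (stdGauss n)).map (fun p => a • p.1 + b • p.2) =
      (stdGauss n).map fun z => c • z := by
  have e := measurePreserving_arrowProdEquivProdArrow ℝ ℝ (Fin n)
    (fun _ => gaussianReal 0 1) (fun _ => gaussianReal 0 1)
  have e' : (stdGauss n).prod (stdGauss n) = (Measure.pi fun _ : Fin n =>
      (gaussianReal 0 1).prod (gaussianReal 0 1)).map
        (MeasurableEquiv.arrowProdEquivProdArrow ℝ ℝ (Fin n)) := by
    rw [e.map_eq]; rfl
  have h1 : ((gaussianReal 0 1).prod (gaussianReal 0 1)).map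
      (fun p : ℝ × ℝ => a * p.1 + b * p.2) = (gaussianReal 0 1).map fun t => c * t := by
    have h2 : ((gaussianReal 0 1).prod (gaussianReal 0 1)).map
        (fun p : ℝ × ℝ => a * p.1 + b * p.2) =
        ((gaussianReal 0 1).map fun t => a * t) ∗ ((gaussianReal 0 1).map fun t => b * t) := by
      rw [Measure.conv, Measure.map_prod_map _ _ (by fun_prop) (by fun_prop),
        Measure.map_map (by fun_prop) (by fun_prop)]
      rfl
    rw [h2, gaussianReal_map_const_mul, gaussianReal_map_const_mul, gaussianReal_map_const_mul,
      gaussianReal_conv_gaussianReal]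
    congr 1
    · simp
    · ext; simp [h]
  have hσ (i : Fin n) : SigmaFinite ((gaussianReal 0 1).map (fun t : ℝ => c * t)) := by
    rw [gaussianReal_map_const_mul]; infer_instance
  have hσ' (i : Fin n) : SigmaFinite (((gaussianReal 0 1).prod (gaussianReal 0 1)).map
      (fun p : ℝ × ℝ => a * p.1 + b * p.2)) := by
    rw [h1]; exact hσ i
  rw [e', Measure.map_map (by fun_prop) (MeasurableEquiv.measurable _), stdGauss_eq]
  have : ((fun p : (Fin n → ℝ) × (Fin n → ℝ) => a • p.1 + b • p.2) ∘
      (MeasurableEquiv.arrowProdEquivProdArrow ℝ ℝ (Fin n))) =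
      fun x i => (fun p : ℝ × ℝ => a * p.1 + b * p.2) (x i) := by
    ext x i
    simp [MeasurableEquiv.arrowProdEquivProdArrow, Equiv.arrowProdEquivProdArrow]
  have h3 : (fun z : Fin n → ℝ => c • z) = fun z i => (fun t : ℝ => c * t) (z i) := by
    ext; simp
  rw [this, h3, Measure.pi_map_pi (μ := fun _ => (gaussianReal 0 1).prod (gaussianReal 0 1))
      (f := fun _ (p : ℝ × ℝ) => a * p.1 + b * p.2) (fun i => by fun_prop),
    Measure.pi_map_pi (μ := fun _ => gaussianReal 0 1)
      (f := fun _ (t : ℝ) => c * t) (fun i => by fun_prop)]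
  simp only [h1]

lemma integrable_pow_gaussianReal (v : ℝ≥0) (k : ℕ) :
    Integrable (fun x : ℝ => x ^ k) (gaussianReal 0 v) := by
  have h := (memLp_id_gaussianReal (μ := 0) (v := v) (k : ℝ≥0))
  rcases Nat.eq_zero_or_pos k with rfl | hk
  · simp
  · refine (integrable_norm_iff (by fun_prop)).1 ?_
    simpa [norm_pow] using h.integrable_norm_pow (by omega)

lemma integrable_norm_pow_stdGauss (n k : ℕ) :
    Integrable (fun z : Fin n → ℝ => ‖z‖ ^ k) (stdGauss n) := by
  have h : Integrable (fun z : Fin n → ℝ => 1 + ∑ i, |z i ^ k|) (stdGauss n) := by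
    refine (integrable_const _).add (integrable_finsetSum _ fun i _ => ?_)
    exact integrable_comp_eval (μ := fun _ : Fin n => gaussianReal 0 1) (i := i)
      (f := fun x => |x ^ k|) (integrable_pow_gaussianReal 1 k).abs
  refine h.mono' (by fun_prop) (ae_of_all _ fun z => ?_)
  have h0 : 0 ≤ ∑ i, |z i ^ k| := Finset.sum_nonneg fun _ _ => abs_nonneg _
  rw [norm_pow, norm_norm]
  rcases isEmpty_or_nonempty (Fin n) with hn | hn
  · have : ‖z‖ = 0 := by simp [Subsingleton.elim z 0]
    rw [this]
    exact (pow_le_one₀ le_rfl zero_le_one).trans (by linarith)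
  · obtain ⟨i, hi⟩ := Finite.exists_max fun i => ‖z i‖
    rw [((pi_norm_le_iff_of_nonneg (norm_nonneg _)).2 hi).antisymm (norm_le_pi_norm z i),
      Real.norm_eq_abs, ← abs_pow]
    have := Finset.single_le_sum (f := fun i => |z i ^ k|) (fun _ _ => abs_nonneg _)
      (Finset.mem_univ i)
    linarith

lemma integral_eval_stdGauss {n : ℕ} (i : Fin n) : ∫ z, z i ∂(stdGauss n) = 0 := by
  have := integral_comp_eval (μ := fun _ : Fin n => gaussianReal 0 1) (i := i)
      (f := fun x : ℝ => x) (by fun_prop)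
  rw [integral_id_gaussianReal] at this
  exact this

lemma integral_sq_gaussianReal (v : ℝ≥0) : ∫ x, x ^ 2 ∂(gaussianReal 0 v) = v := by
  have := variance_fun_id_gaussianReal (μ := 0) (v := v)
  rw [variance_eq_integral (by fun_prop)] at this
  simpa using this

lemma integral_sq_eval_stdGauss {n : ℕ} (i : Fin n) : ∫ z, z i ^ 2 ∂(stdGauss n) = 1 := by
  have := integral_comp_eval (μ := fun _ : Fin n => gaussianReal 0 1) (i := i)
      (f := fun x : ℝ => x ^ 2) (by fun_prop)
  rw [integral_sq_gaussianReal] at this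
  exact_mod_cast this

lemma integrable_eval_stdGauss {n : ℕ} (i : Fin n) :
    Integrable (fun z : Fin n → ℝ => z i) (stdGauss n) := by
  have := integrable_comp_eval (μ := fun _ : Fin n => gaussianReal 0 1) (i := i)
      (f := fun x : ℝ => x ^ 1) (integrable_pow_gaussianReal 1 1)
  simp only [pow_one] at this
  exact this

lemma integrable_mul_eval_stdGauss {n : ℕ} (i j : Fin n) :
    Integrable (fun z : Fin n → ℝ => z i * z j) (stdGauss n) := by
  refine (integrable_norm_pow_stdGauss n 2).mono' (by fun_prop) (ae_of_all _ fun z => ?_)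
  rw [norm_mul, sq]
  exact mul_le_mul (norm_le_pi_norm z i) (norm_le_pi_norm z j) (norm_nonneg _) (norm_nonneg _)

lemma integrable_normSq_stdGauss (n : ℕ) : Integrable normSq (stdGauss n) := by
  unfold normSq
  exact integrable_finsetSum _ fun i _ => by simpa [sq] using integrable_mul_eval_stdGauss i i

lemma integral_normSq_stdGauss (n : ℕ) : ∫ z, normSq z ∂(stdGauss n) = n := by
  unfold normSq
  rw [integral_finsetSum _ fun i _ => by simpa [sq] using integrable_mul_eval_stdGauss i i]
  simp [integral_sq_eval_stdGauss]

lemma integral_mul_eval_stdGauss {n : ℕ} {i j : Fin n} (hij : i ≠ j) :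
    ∫ z, z i * z j ∂(stdGauss n) = 0 := by
  have h := iIndepFun_pi (μ := fun _ : Fin n => gaussianReal 0 1) (X := fun _ x => x)
    (fun i => by fun_prop)
  have h2 := (h.indepFun hij).integral_mul_eq_mul_integral
    (measurable_pi_apply i).aestronglyMeasurable (measurable_pi_apply j).aestronglyMeasurable
  have h3 := integral_eval_stdGauss i
  unfold stdGauss gaussianVec at *
  simp only [Pi.zero_apply] at *
  have h4 : ∫ z : Fin n → ℝ, z i * z j ∂(Measure.pi fun _ : Fin n => gaussianReal 0 1)
    = (∫ z : Fin n → ℝ, z i ∂(Measure.pi fun _ : Fin n => gaussianReal 0 1)) *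
    ∫ z : Fin n → ℝ, z j ∂(Measure.pi fun _ : Fin n => gaussianReal 0 1) := h2
  rw [h4, h3, zero_mul]

lemma integrable_sum_mul_stdGauss {n : ℕ} (c : Fin n → ℝ) :
    Integrable (fun z : Fin n → ℝ => ∑ i, z i * c i) (stdGauss n) :=
  integrable_finsetSum _ fun i _ => (integrable_eval_stdGauss i).mul_const _

lemma integral_sum_mul_stdGauss {n : ℕ} (c : Fin n → ℝ) :
    ∫ z, ∑ i, z i * c i ∂(stdGauss n) = 0 := by
  rw [integral_finsetSum _ fun i _ => (integrable_eval_stdGauss i).mul_const _]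
  simp [integral_mul_const, integral_eval_stdGauss]

lemma integral_sum_mul_sq_stdGauss {n : ℕ} (c : Fin n → ℝ) :
    ∫ z, (∑ i, z i * c i) ^ 2 ∂(stdGauss n) = normSq c := by
  have h (z : Fin n → ℝ) : (∑ i, z i * c i) ^ 2 = ∑ i, ∑ j, z i * z j * (c i * c j) := by
    rw [sq, Finset.sum_mul_sum]
    exact Finset.sum_congr rfl fun i _ => Finset.sum_congr rfl fun j _ => by ring
  simp_rw [h]
  have hI (i j : Fin n) := (integrable_mul_eval_stdGauss i j).mul_const (c i * c j)
  rw [integral_finsetSum _ fun i _ => integrable_finsetSum _ fun j _ => hI i j]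
  refine Finset.sum_congr rfl fun i _ => ?_
  rw [integral_finsetSum _ fun j _ => hI i j, Finset.sum_eq_single i]
  · rw [integral_mul_const]
    have := integral_sq_eval_stdGauss i
    simp only [sq] at this ⊢
    rw [this, one_mul]
  · intro j _ hj
    rw [integral_mul_const, integral_mul_eval_stdGauss hj.symm, zero_mul]
  · simp

/-! ### Gaussian mixtures and posterior distributions -/

/-- The density of `θ + √v Z` at `x`, where `θ` is a random vector on `(Ω, π)` and `Z` is an
independent standard Gaussian vector. -/
noncomputable def mixDens {Ω : Type*} [MeasurableSpace Ω] (π : Measure Ω) {n : ℕ}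
    (θ : Ω → Fin n → ℝ) (v : ℝ) (x : Fin n → ℝ) : ℝ :=
  ∫ ω, gaussDens v (x - θ ω) ∂π

/-- The posterior distribution on `Ω` after observing `θ + √v Z = x`. -/
noncomputable def bayesPost {Ω : Type*} [MeasurableSpace Ω] (π : Measure Ω) {n : ℕ}
    (θ : Ω → Fin n → ℝ) (v : ℝ) (x : Fin n → ℝ) : Measure Ω :=
  π.tilted fun ω => -normSq (x - θ ω) / (2 * v)

lemma mixDens_eq {Ω : Type*} [MeasurableSpace Ω] {π : Measure Ω} {n : ℕ} {θ : Ω → Fin n → ℝ}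
    {v : ℝ} (x : Fin n → ℝ) :
    mixDens π θ v x = (√(2 * Real.pi * v))⁻¹ ^ n *
      ∫ ω, Real.exp (-normSq (x - θ ω) / (2 * v)) ∂π := by
  unfold mixDens gaussDens
  rw [integral_const_mul]

/-- The joint law of `(ω, θ ω + √v Z)`. -/
lemma map_obs_eq_withDensity {Ω : Type*} [MeasurableSpace Ω] {π : Measure Ω} [SFinite π]
    {n : ℕ} {θ : Ω → Fin n → ℝ} {v : ℝ} (hθ : Measurable θ) (hv : 0 < v) :
    (π.prod (stdGauss n)).map (fun p => (p.1, θ p.1 + √v • p.2)) =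
      (π.prod volume).withDensity fun p => ENNReal.ofReal (gaussDens v (p.2 - θ p.1)) := by
  refine Measure.ext_of_lintegral _ fun f hf => ?_
  have hv' : v.toNNReal ≠ 0 := by simpa using hv
  have hc : ((v.toNNReal : ℝ≥0) : ℝ) = v := Real.coe_toNNReal _ hv.le
  rw [lintegral_map hf (by fun_prop), lintegral_withDensity_eq_lintegral_mul _ (by fun_prop) hf,
    lintegral_prod _ (by fun_prop), lintegral_prod _ (by fun_prop)]
  refine lintegral_congr fun ω => ?_
  have h1 := gaussianVec_eq_map (θ ω) v.toNNReal
  rw [gaussianVec_eq_withDensity _ hv', hc] at h1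
  have h2 : ∫⁻ x, f (ω, x) ∂(volume.withDensity
      fun x => ENNReal.ofReal (gaussDens v (x - θ ω))) =
      ∫⁻ z, f (ω, θ ω + √v • z) ∂(stdGauss n) := by
    rw [h1, lintegral_map (by fun_prop) (by fun_prop)]
  rw [← h2, lintegral_withDensity_eq_lintegral_mul _ (by fun_prop) (by fun_prop)]
  rfl

section mixture

variable {Ω : Type*} [MeasurableSpace Ω] {π : Measure Ω} [IsProbabilityMeasure π] {n : ℕ}
  {θ : Ω → Fin n → ℝ} {R v : ℝ}

lemma integrable_exp_normSq (hθ : Measurable θ) (hv : 0 < v) (x : Fin n → ℝ) :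
    Integrable (fun ω => Real.exp (-normSq (x - θ ω) / (2 * v))) π := by
  refine (integrable_const (1 : ℝ)).mono' (by fun_prop) (ae_of_all _ fun ω => ?_)
  rw [Real.norm_eq_abs, abs_of_pos (Real.exp_pos _), Real.exp_le_one_iff, neg_div]
  have := normSq_nonneg (x - θ ω)
  have : 0 ≤ normSq (x - θ ω) / (2 * v) := by positivity
  linarith

lemma integrable_gaussDens_sub (hθ : Measurable θ) (hv : 0 < v) (x : Fin n → ℝ) :
    Integrable (fun ω => gaussDens v (x - θ ω)) π :=
  (integrable_exp_normSq hθ hv x).const_mul _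

lemma mixDens_pos (hθ : Measurable θ) (hv : 0 < v) (x : Fin n → ℝ) : 0 < mixDens π θ v x := by
  rw [mixDens_eq]
  have := integral_exp_pos (integrable_exp_normSq (π := π) hθ hv x)
  positivity

lemma measurable_mixDens (hθ : Measurable θ) : Measurable (mixDens π θ v) := by
  have : Measurable (Function.uncurry fun (x : Fin n → ℝ) ω => gaussDens v (x - θ ω)) := by
    unfold Function.uncurry; fun_prop
  exact this.stronglyMeasurable.integral_prod_right.measurable

lemma lintegral_gaussDens_sub (hθ : Measurable θ) (hv : 0 < v) (x : Fin n → ℝ) :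
    ∫⁻ ω, ENNReal.ofReal (gaussDens v (x - θ ω)) ∂π = ENNReal.ofReal (mixDens π θ v x) := by
  rw [mixDens, ofReal_integral_eq_lintegral_ofReal (integrable_gaussDens_sub hθ hv x)
    (ae_of_all _ fun ω => (gaussDens_pos hv _).le)]

lemma isProbabilityMeasure_bayesPost (hθ : Measurable θ) (hv : 0 < v) (x : Fin n → ℝ) :
    IsProbabilityMeasure (bayesPost π θ v x) :=
  isProbabilityMeasure_tilted (integrable_exp_normSq hθ hv x)

/-- Bayes' formula. -/
lemma integral_gaussDens_mul (hθ : Measurable θ) (hv : 0 < v) (x : Fin n → ℝ) (F : Ω → ℝ) :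
    ∫ ω, gaussDens v (x - θ ω) * F ω ∂π = mixDens π θ v x * ∫ ω, F ω ∂(bayesPost π θ v x) := by
  have := integral_exp_pos (integrable_exp_normSq (π := π) hθ hv x)
  rw [bayesPost, integral_tilted, mixDens_eq, mul_assoc, ← integral_const_mul,
    ← integral_const_mul]
  refine integral_congr_ae (ae_of_all _ fun ω => ?_)
  simp only [smul_eq_mul, gaussDens, neg_div] at this ⊢
  field_simp

lemma normSq_sub_le {x y : Fin n → ℝ} (hy : ‖y‖ ≤ R) :
    normSq (x - y) ≤ 2 * n * (‖x‖ ^ 2 + R ^ 2) := by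
  have h1 := normSq_le (x - y)
  have h2 : ‖x - y‖ ≤ ‖x‖ + R := (norm_sub_le x y).trans (by linarith)
  have h3 : ‖x - y‖ ^ 2 ≤ 2 * (‖x‖ ^ 2 + R ^ 2) := by
    nlinarith [norm_nonneg (x - y), sq_nonneg (‖x‖ - R)]
  have : (n : ℝ) * ‖x - y‖ ^ 2 ≤ n * (2 * (‖x‖ ^ 2 + R ^ 2)) :=
    mul_le_mul_of_nonneg_left h3 (Nat.cast_nonneg n)
  linarith

/-- A Gaussian mixture with bounded centres has a log-density of at most quadratic growth. -/
lemma exists_abs_log_mixDens_le (hθ : Measurable θ) (hR : ∀ᵐ ω ∂π, ‖θ ω‖ ≤ R) (hv : 0 < v) :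
    ∃ A : ℝ, ∀ x, |Real.log (mixDens π θ v x)| ≤ A * (1 + ‖x‖ ^ 2) := by
  refine ⟨|Real.log ((√(2 * Real.pi * v))⁻¹ ^ n)| + n / v * R ^ 2 + n / v, fun x => ?_⟩
  have hI := integrable_exp_normSq (π := π) hθ hv x
  have hpos := integral_exp_pos hI
  rw [mixDens_eq, Real.log_mul (by positivity) hpos.ne']
  have hup : ∫ ω, Real.exp (-normSq (x - θ ω) / (2 * v)) ∂π ≤ 1 := by
    calc _ ≤ ∫ _ω, (1 : ℝ) ∂π := by
          refine integral_mono hI (integrable_const _) fun ω => ?_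
          simp only [Real.exp_le_one_iff, neg_div]
          have := normSq_nonneg (x - θ ω)
          have : 0 ≤ normSq (x - θ ω) / (2 * v) := by positivity
          linarith
      _ = 1 := by simp
  have hlow : Real.exp (-(n / v * (‖x‖ ^ 2 + R ^ 2))) ≤
      ∫ ω, Real.exp (-normSq (x - θ ω) / (2 * v)) ∂π := by
    calc _ = ∫ _ω, Real.exp (-(n / v * (‖x‖ ^ 2 + R ^ 2))) ∂π := by simp
      _ ≤ _ := by
          refine integral_mono_ae (integrable_const _) hI ?_
          filter_upwards [hR] with ω hω
          refine Real.exp_le_exp.2 ?_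
          have h1 : normSq (x - θ ω) / (2 * v) ≤ 2 * n * (‖x‖ ^ 2 + R ^ 2) / (2 * v) :=
            div_le_div_of_nonneg_right (normSq_sub_le hω) (by positivity)
          have h2 : 2 * n * (‖x‖ ^ 2 + R ^ 2) / (2 * v) = n / v * (‖x‖ ^ 2 + R ^ 2) := by
            field_simp
          rw [neg_div]; linarith
  have h1 := Real.log_nonpos hpos.le hup
  have h2 := Real.log_le_log (Real.exp_pos _) hlow
  rw [Real.log_exp] at h2
  refine (abs_add_le _ _).trans ?_
  rw [abs_of_nonpos h1]
  have h3 : 0 ≤ |Real.log ((√(2 * Real.pi * v))⁻¹ ^ n)| := abs_nonneg _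
  have h4 : 0 ≤ (n : ℝ) / v * R ^ 2 := by positivity
  have h5 : 0 ≤ ‖x‖ ^ 2 := by positivity
  have h6 : 0 ≤ (n : ℝ) / v := by positivity
  nlinarith [mul_nonneg h3 h5, mul_nonneg h4 h5]

lemma measurable_log_mixDens (hθ : Measurable θ) :
    Measurable fun x => Real.log (mixDens π θ v x) :=
  Real.measurable_log.comp (measurable_mixDens hθ)

/-- Functions of quadratic growth are integrable along Gaussian perturbations of a bounded
random vector. -/
lemma integrable_comp_add_smul {g : (Fin n → ℝ) → ℝ} (hg : Measurable g) {A : ℝ}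
    (hA : ∀ x, |g x| ≤ A * (1 + ‖x‖ ^ 2)) (hθ : Measurable θ) (hR : ∀ᵐ ω ∂π, ‖θ ω‖ ≤ R)
    (c : ℝ) :
    Integrable (fun p : Ω × (Fin n → ℝ) => g (θ p.1 + c • p.2)) (π.prod (stdGauss n)) := by
  have h2 : Integrable (fun p : Ω × (Fin n → ℝ) => ‖p.2‖ ^ 2) (π.prod (stdGauss n)) :=
    (integrable_norm_pow_stdGauss n 2).comp_snd π
  have h : Integrable (fun p : Ω × (Fin n → ℝ) => |A| * (1 + 2 * (R ^ 2 + c ^ 2 * ‖p.2‖ ^ 2)))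
      (π.prod (stdGauss n)) :=
    (((integrable_const _).add ((h2.const_mul _)) |>.const_mul 2
      |> (integrable_const (1 : ℝ)).add).const_mul _)
  refine h.mono' (hg.comp (by fun_prop)).aestronglyMeasurable ?_
  have hR' : ∀ᵐ p ∂(π.prod (stdGauss n)), ‖θ p.1‖ ≤ R :=
    Measure.quasiMeasurePreserving_fst.ae hR
  filter_upwards [hR'] with p hp
  rw [Real.norm_eq_abs]
  refine (hA _).trans ?_
  have h3 : ‖θ p.1 + c • p.2‖ ≤ R + |c| * ‖p.2‖ := by
    refine (norm_add_le _ _).trans ?_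
    rw [norm_smul, Real.norm_eq_abs]; linarith
  have h4 : ‖θ p.1 + c • p.2‖ ^ 2 ≤ 2 * (R ^ 2 + c ^ 2 * ‖p.2‖ ^ 2) := by
    have h5 := pow_le_pow_left₀ (norm_nonneg _) h3 2
    have h6 : (|c| * ‖p.2‖) ^ 2 = c ^ 2 * ‖p.2‖ ^ 2 := by rw [mul_pow, sq_abs]
    nlinarith [sq_nonneg (R - |c| * ‖p.2‖)]
  calc A * (1 + ‖θ p.1 + c • p.2‖ ^ 2) ≤ |A| * (1 + ‖θ p.1 + c • p.2‖ ^ 2) :=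
        mul_le_mul_of_nonneg_right (le_abs_self A) (by positivity)
    _ ≤ _ := mul_le_mul_of_nonneg_left (by linarith) (abs_nonneg A)

lemma integrable_comp_const_add_smul {n : ℕ} {g : (Fin n → ℝ) → ℝ} (hg : Measurable g) {A : ℝ}
    (hA : ∀ x, |g x| ≤ A * (1 + ‖x‖ ^ 2)) (y : Fin n → ℝ) (c : ℝ) :
    Integrable (fun z => g (y + c • z)) (stdGauss n) := by
  have h := integrable_comp_add_smul (π := stdGauss n) (θ := fun _ => y) (R := ‖y‖)
    hg hA (by fun_prop) (ae_of_all _ fun _ => le_rfl) c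
  exact ((integrable_prod_iff
    (hg.comp (by fun_prop)).aestronglyMeasurable).1 h).1.exists.choose_spec

lemma measurable_integral_add_smul {n : ℕ} {g : (Fin n → ℝ) → ℝ} (hg : Measurable g) (c : ℝ) :
    Measurable fun x => ∫ z, g (x + c • z) ∂(stdGauss n) := by
  have : Measurable (Function.uncurry fun (x z : Fin n → ℝ) => g (x + c • z)) :=
    hg.comp (by fun_prop)
  exact this.stronglyMeasurable.integral_prod_right.measurable

/-- Quadratic growth is preserved by Gaussian smoothing. -/
lemma abs_integral_add_smul_le {n : ℕ} {g : (Fin n → ℝ) → ℝ} {A : ℝ}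
    (hA : ∀ x, |g x| ≤ A * (1 + ‖x‖ ^ 2)) (c : ℝ) (x : Fin n → ℝ) :
    |∫ z, g (x + c • z) ∂(stdGauss n)| ≤
      (|A| * 2 * (1 + c ^ 2 * ∫ z, ‖z‖ ^ 2 ∂(stdGauss n))) * (1 + ‖x‖ ^ 2) := by
  have hI2 := integrable_norm_pow_stdGauss n 2
  have h0 : 0 ≤ ∫ z, ‖z‖ ^ 2 ∂(stdGauss n) := integral_nonneg fun z => by positivity
  have h1 : |∫ z, g (x + c • z) ∂(stdGauss n)| ≤
      ∫ z, |A| * 2 * (1 + ‖x‖ ^ 2 + c ^ 2 * ‖z‖ ^ 2) ∂(stdGauss n) := by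
    refine norm_integral_le_of_norm_le (f := fun z => g (x + c • z))
      (((integrable_const _).add (hI2.const_mul (c ^ 2))).const_mul _) (ae_of_all _ fun z => ?_)
    rw [Real.norm_eq_abs]
    refine (hA _).trans ?_
    have h3 : ‖x + c • z‖ ≤ ‖x‖ + |c| * ‖z‖ := by
      refine (norm_add_le _ _).trans ?_
      rw [norm_smul, Real.norm_eq_abs]
    have h4 : ‖x + c • z‖ ^ 2 ≤ 2 * (‖x‖ ^ 2 + c ^ 2 * ‖z‖ ^ 2) := by
      have h5 := pow_le_pow_left₀ (norm_nonneg _) h3 2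
      have h6 : (|c| * ‖z‖) ^ 2 = c ^ 2 * ‖z‖ ^ 2 := by rw [mul_pow, sq_abs]
      nlinarith [sq_nonneg (‖x‖ - |c| * ‖z‖)]
    calc A * (1 + ‖x + c • z‖ ^ 2) ≤ |A| * (1 + ‖x + c • z‖ ^ 2) :=
          mul_le_mul_of_nonneg_right (le_abs_self A) (by positivity)
      _ ≤ |A| * (2 * (1 + ‖x‖ ^ 2 + c ^ 2 * ‖z‖ ^ 2)) :=
          mul_le_mul_of_nonneg_left (by linarith) (abs_nonneg A)
      _ = _ := by ring
  refine h1.trans ?_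
  rw [integral_const_mul, integral_add (integrable_const _) (hI2.const_mul (c ^ 2)),
    integral_const_mul]
  simp only [integral_const, probReal_univ, one_smul, mul_assoc]
  refine mul_le_mul_of_nonneg_left ?_ (abs_nonneg A)
  have : 0 ≤ c ^ 2 * (∫ z, ‖z‖ ^ 2 ∂(stdGauss n)) * ‖x‖ ^ 2 := by positivity
  nlinarith

lemma lintegral_obs (hθ : Measurable θ) (hv : 0 < v) {F : Ω → (Fin n → ℝ) → ℝ≥0∞}
    (hF : Measurable (Function.uncurry F)) :
    ∫⁻ p, F p.1 (θ p.1 + √v • p.2) ∂(π.prod (stdGauss n)) =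
      ∫⁻ x, ∫⁻ ω, ENNReal.ofReal (gaussDens v (x - θ ω)) * F ω x ∂π := by
  have h := lintegral_map (μ := π.prod (stdGauss n)) hF
    (show Measurable fun p : Ω × (Fin n → ℝ) => (p.1, θ p.1 + √v • p.2) by fun_prop)
  rw [map_obs_eq_withDensity hθ hv,
    lintegral_withDensity_eq_lintegral_mul _ (by fun_prop) hF,
    lintegral_prod_symm _ (by fun_prop)] at h
  exact h.symm

lemma integral_obs (hθ : Measurable θ) (hv : 0 < v) {F : Ω → (Fin n → ℝ) → ℝ}
    (hF : Measurable (Function.uncurry F))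
    (hi : Integrable (fun p => F p.1 (θ p.1 + √v • p.2)) (π.prod (stdGauss n))) :
    ∫ p, F p.1 (θ p.1 + √v • p.2) ∂(π.prod (stdGauss n)) =
      ∫ x, ∫ ω, gaussDens v (x - θ ω) * F ω x ∂π := by
  have hm : Measurable fun p : Ω × (Fin n → ℝ) => (p.1, θ p.1 + √v • p.2) := by fun_prop
  have h := integral_map (μ := π.prod (stdGauss n)) hm.aemeasurable
    (f := Function.uncurry F) hF.aestronglyMeasurable
  have h' : Integrable (Function.uncurry F)
      ((π.prod (stdGauss n)).map fun p => (p.1, θ p.1 + √v • p.2)) :=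
    (integrable_map_measure hF.aestronglyMeasurable hm.aemeasurable).2 hi
  have hd : Measurable fun p : Ω × (Fin n → ℝ) => ENNReal.ofReal (gaussDens v (p.2 - θ p.1)) := by
    fun_prop
  rw [map_obs_eq_withDensity hθ hv, integrable_withDensity_iff_integrable_smul' hd (by simp)] at h'
  rw [map_obs_eq_withDensity hθ hv, integral_withDensity_eq_integral_toReal_smul hd (by simp),
    integral_prod_symm _ h'] at h
  rw [show ∫ p, F p.1 (θ p.1 + √v • p.2) ∂(π.prod (stdGauss n)) =
    ∫ p, Function.uncurry F (p.1, θ p.1 + √v • p.2) ∂(π.prod (stdGauss n)) from rfl, ← h]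
  refine integral_congr_ae (ae_of_all _ fun x => ?_)
  refine integral_congr_ae (ae_of_all _ fun ω => ?_)
  simp [ENNReal.toReal_ofReal (gaussDens_pos hv _).le]

lemma measurable_integral_bayesPost (hθ : Measurable θ) (hv : 0 < v)
    {F : Ω → (Fin n → ℝ) → ℝ} (hF : Measurable (Function.uncurry F)) :
    Measurable fun x => ∫ ω, F ω x ∂(bayesPost π θ v x) := by
  have h1 : (fun x => ∫ ω, F ω x ∂(bayesPost π θ v x)) =
      fun x => (∫ ω, gaussDens v (x - θ ω) * F ω x ∂π) / mixDens π θ v x := by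
    ext x
    rw [integral_gaussDens_mul hθ hv x (fun ω => F ω x),
      mul_div_cancel_left₀ _ (mixDens_pos hθ hv x).ne']
  have h2 : Measurable (Function.uncurry fun (x : Fin n → ℝ) ω =>
      gaussDens v (x - θ ω) * F ω x) := by
    have : Measurable fun p : (Fin n → ℝ) × Ω => F p.2 p.1 := hF.comp measurable_swap
    unfold Function.uncurry; fun_prop
  rw [h1]
  exact h2.stronglyMeasurable.integral_prod_right.measurable.div (measurable_mixDens hθ)

/-- The tower property of the posterior distribution. -/
lemma integral_integral_bayesPost (hθ : Measurable θ) (hv : 0 < v)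
    {F : Ω → (Fin n → ℝ) → ℝ} (hF : Measurable (Function.uncurry F)) {K : ℝ}
    (hK : ∀ᵐ ω ∂π, ∀ x, |F ω x| ≤ K) :
    ∫ p, F p.1 (θ p.1 + √v • p.2) ∂(π.prod (stdGauss n)) =
      ∫ p, (∫ ω, F ω (θ p.1 + √v • p.2) ∂(bayesPost π θ v (θ p.1 + √v • p.2)))
        ∂(π.prod (stdGauss n)) := by
  have hg := measurable_integral_bayesPost (π := π) hθ hv hF
  have hb (x : Fin n → ℝ) : |∫ ω, F ω x ∂(bayesPost π θ v x)| ≤ K := by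
    have := isProbabilityMeasure_bayesPost (π := π) hθ hv x
    have hK' : ∀ᵐ ω ∂(bayesPost π θ v x), ‖F ω x‖ ≤ K := by
      filter_upwards [(tilted_absolutelyContinuous π _).ae_le hK] with ω hω using hω x
    simpa using norm_integral_le_of_norm_le_const hK'
  have hi1 : Integrable (fun p => F p.1 (θ p.1 + √v • p.2)) (π.prod (stdGauss n)) := by
    refine (integrable_const K).mono' ?_ ?_
    · exact (hF.comp (show Measurable fun p : Ω × (Fin n → ℝ) => (p.1, θ p.1 + √v • p.2) by
        fun_prop)).aestronglyMeasurable
    · filter_upwards [Measure.quasiMeasurePreserving_fst.ae hK] with p hp using hp _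
  have hi2 : Integrable (fun p : Ω × (Fin n → ℝ) => (∫ ω, F ω (θ p.1 + √v • p.2)
      ∂(bayesPost π θ v (θ p.1 + √v • p.2)))) (π.prod (stdGauss n)) := by
    refine (integrable_const K).mono' ?_ (ae_of_all _ fun p => hb _)
    exact (hg.comp (show Measurable fun p : Ω × (Fin n → ℝ) => θ p.1 + √v • p.2 by
      fun_prop)).aestronglyMeasurable
  rw [integral_obs hθ hv hF hi1, integral_obs (F := fun _ x => ∫ ω, F ω x ∂(bayesPost π θ v x))
    hθ hv (hg.comp measurable_snd) hi2]
  refine integral_congr_ae (ae_of_all _ fun x => ?_)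
  simp only
  rw [integral_gaussDens_mul hθ hv, integral_mul_const]
  rfl

/-- Adding independent Gaussian noises adds up their variances. -/
lemma integral_comp_add_smul_add_smul {g : (Fin n → ℝ) → ℝ} (hg : Measurable g) {A : ℝ}
    (hA : ∀ x, |g x| ≤ A * (1 + ‖x‖ ^ 2)) (hθ : Measurable θ) (hR : ∀ᵐ ω ∂π, ‖θ ω‖ ≤ R)
    {a b c : ℝ} (h : a ^ 2 + b ^ 2 = c ^ 2) :
    Integrable (fun p : Ω × (Fin n → ℝ) => ∫ z, g (θ p.1 + a • p.2 + b • z) ∂(stdGauss n))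
      (π.prod (stdGauss n)) ∧
    ∫ p, ∫ z, g (θ p.1 + a • p.2 + b • z) ∂(stdGauss n) ∂(π.prod (stdGauss n)) =
      ∫ p, g (θ p.1 + c • p.2) ∂(π.prod (stdGauss n)) := by
  have hH := measurable_integral_add_smul hg b
  have hi : Integrable (fun p : Ω × (Fin n → ℝ) => ∫ z, g (θ p.1 + a • p.2 + b • z) ∂(stdGauss n))
      (π.prod (stdGauss n)) := integrable_comp_add_smul hH
        (abs_integral_add_smul_le hA b) hθ hR a
  refine ⟨hi, ?_⟩
  rw [integral_prod _ hi, integral_prod _ (integrable_comp_add_smul hg hA hθ hR c)]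
  refine integral_congr_ae (ae_of_all _ fun ω => ?_)
  have hg' : Measurable fun x => g (θ ω + x) := by fun_prop
  have hmap := map_smul_add_smul_stdGauss (n := n) h
  have e1 : ∫ z, g (θ ω + c • z) ∂(stdGauss n) =
      ∫ p : (Fin n → ℝ) × (Fin n → ℝ), g (θ ω + (a • p.1 + b • p.2))
        ∂((stdGauss n).prod (stdGauss n)) := by
    rw [← integral_map (f := fun x => g (θ ω + x)) (φ := fun z : Fin n → ℝ => c • z)
      (by fun_prop) hg'.aestronglyMeasurable, ← hmap,
      integral_map (by fun_prop) hg'.aestronglyMeasurable]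
  have hI2 : Integrable (fun p : (Fin n → ℝ) × (Fin n → ℝ) => g (θ ω + (a • p.1 + b • p.2)))
        ((stdGauss n).prod (stdGauss n)) := by
    have h1 : Integrable (fun x => g (θ ω + x)) ((stdGauss n).map fun z => c • z) :=
      (integrable_map_measure hg'.aestronglyMeasurable (by fun_prop)).2
        (integrable_comp_const_add_smul hg hA (θ ω) c)
    rw [← hmap] at h1
    exact (integrable_map_measure hg'.aestronglyMeasurable (by fun_prop)).1 h1
  simp only
  rw [e1, integral_prod _ hI2]
  simp only [add_assoc]

end mixture

/-! ### Entropy of a Gaussian mixture as a function of the noise level -/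

lemma one_add_add_sub_le_exp (y : ℝ) : 1 + y + y ^ 2 / 2 - |y| ^ 3 / 2 ≤ Real.exp y := by
  rcases le_or_gt |y| 1 with h | h
  · have h1 := abs_le.1 (Real.exp_bound h (n := 3) (by norm_num))
    norm_num [Finset.sum_range_succ, Nat.factorial] at h1
    have h2 : 0 ≤ |y| ^ 3 := by positivity
    linarith [h1.1]
  · rcases le_or_gt 0 y with h0 | h0
    · have := Real.quadratic_le_exp_of_nonneg h0
      have h2 : 0 ≤ |y| ^ 3 := by positivity
      linarith
    · rw [abs_of_neg h0] at h ⊢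
      have := Real.exp_pos y
      nlinarith [mul_pos (sub_pos.2 h) (sub_pos.2 h), sq_nonneg y]

/-- A second-order lower bound for the log-Laplace transform of a bounded centred variable. -/
lemma le_log_integral_exp {Ω : Type*} [MeasurableSpace Ω] {P : Measure Ω} [IsProbabilityMeasure P]
    {Y : Ω → ℝ} {k : ℝ} (hY : AEStronglyMeasurable Y P) (hk : ∀ᵐ ω ∂P, |Y ω| ≤ k)
    (h0 : ∫ ω, Y ω ∂P = 0) :
    1 / 2 * ∫ ω, Y ω ^ 2 ∂P - k ^ 3 / 2 - k ^ 4 / 8 ≤ Real.log (∫ ω, Real.exp (Y ω) ∂P) := by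
  have hk0 : 0 ≤ k := by
    obtain ⟨ω, hω⟩ := hk.exists
    exact (abs_nonneg _).trans hω
  have hI1 : Integrable Y P := (integrable_const k).mono' hY hk
  have hI2 : Integrable (fun ω => Y ω ^ 2) P := by
    refine (integrable_const (k ^ 2)).mono' (hY.pow 2) ?_
    filter_upwards [hk] with ω hω
    rw [norm_pow, Real.norm_eq_abs]
    exact pow_le_pow_left₀ (abs_nonneg _) hω 2
  have hIe : Integrable (fun ω => Real.exp (Y ω)) P := by
    refine (integrable_const (Real.exp k)).mono'
      (Real.continuous_exp.comp_aestronglyMeasurable hY) ?_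
    filter_upwards [hk] with ω hω
    rw [Real.norm_eq_abs, abs_of_pos (Real.exp_pos _)]
    exact Real.exp_le_exp.2 ((le_abs_self _).trans hω)
  have hsq : ∫ ω, Y ω ^ 2 ∂P ≤ k ^ 2 := by
    calc _ ≤ ∫ _ω, k ^ 2 ∂P := by
          refine integral_mono_ae hI2 (integrable_const _) ?_
          filter_upwards [hk] with ω hω
          rw [← sq_abs]
          exact pow_le_pow_left₀ (abs_nonneg _) hω 2
      _ = k ^ 2 := by simp
  have hsq0 : 0 ≤ ∫ ω, Y ω ^ 2 ∂P := integral_nonneg fun ω => sq_nonneg _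
  have hZ1 : 1 ≤ ∫ ω, Real.exp (Y ω) ∂P := by
    calc (1 : ℝ) = ∫ ω, (1 + Y ω) ∂P := by
          rw [integral_add (integrable_const _) hI1, h0]; simp
      _ ≤ _ := integral_mono ((integrable_const _).add hI1) hIe fun ω => by
          have := Real.add_one_le_exp (Y ω)
          simp only; linarith
  have hIa : Integrable (fun ω => 1 - k ^ 3 / 2 + Y ω) P := (integrable_const _).add hI1
  have hZ2 : 1 + (1 / 2 * ∫ ω, Y ω ^ 2 ∂P - k ^ 3 / 2) ≤ ∫ ω, Real.exp (Y ω) ∂P := by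
    calc 1 + (1 / 2 * ∫ ω, Y ω ^ 2 ∂P - k ^ 3 / 2)
        = ∫ ω, (1 - k ^ 3 / 2 + Y ω + 1 / 2 * Y ω ^ 2) ∂P := by
          rw [integral_add hIa (hI2.const_mul _),
            integral_add (integrable_const _) hI1, h0, integral_const_mul]
          simp; ring
      _ ≤ _ := by
          refine integral_mono_ae (hIa.add (hI2.const_mul _)) hIe ?_
          filter_upwards [hk] with ω hω
          have h1 := one_add_add_sub_le_exp (Y ω)
          have h2 := pow_le_pow_left₀ (abs_nonneg _) hω 3
          linarith
  set a := 1 / 2 * ∫ ω, Y ω ^ 2 ∂P with ha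
  set Z := ∫ ω, Real.exp (Y ω) ∂P with hZ
  have hk4 : 0 ≤ k ^ 4 := by positivity
  have hk3 : 0 ≤ k ^ 3 := by positivity
  rcases le_or_gt (a - k ^ 3 / 2) 0 with hz | hz
  · have := Real.log_nonneg hZ1
    linarith
  · have h1 := Real.le_log_one_add_of_nonneg hz.le
    have h2 := Real.log_le_log (by linarith) hZ2
    have h3 : (a - k ^ 3 / 2) - (a - k ^ 3 / 2) ^ 2 / 2 ≤
        2 * (a - k ^ 3 / 2) / (a - k ^ 3 / 2 + 2) := by
      rw [le_div_iff₀ (by linarith)]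
      nlinarith [mul_pos hz (mul_pos hz hz)]
    have h4 : (a - k ^ 3 / 2) ^ 2 ≤ (k ^ 2 / 2) ^ 2 := by
      refine pow_le_pow_left₀ hz.le ?_ 2
      linarith
    nlinarith

lemma ae_bayesPost_le {Ω : Type*} [MeasurableSpace Ω] {π : Measure Ω} {n : ℕ}
    {θ : Ω → Fin n → ℝ} {R v : ℝ} (hR : ∀ᵐ ω ∂π, ‖θ ω‖ ≤ R) (x : Fin n → ℝ) (i : Fin n) :
    ∀ᵐ ω ∂(bayesPost π θ v x), |θ ω i| ≤ R := by
  filter_upwards [(tilted_absolutelyContinuous π _).ae_le hR] with ω hω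
  exact (norm_le_pi_norm (θ ω) i).trans hω

section mixture

variable {Ω : Type*} [MeasurableSpace Ω] {π : Measure Ω} [IsProbabilityMeasure π] {n : ℕ}
  {θ : Ω → Fin n → ℝ} {R v : ℝ}

/-- The increment of the log-density is a log-Laplace transform under the posterior distribution,
which is recentred at an arbitrary `μ`. -/
lemma log_mixDens_add (hθ : Measurable θ) (hv : 0 < v) (x h μ : Fin n → ℝ) :
    Real.log (mixDens π θ v (x + h)) = Real.log (mixDens π θ v x) - normSq h / (2 * v) -
      (∑ i, h i * (x i - μ i)) / v +
      Real.log (∫ ω, Real.exp ((∑ i, h i * (θ ω i - μ i)) / v) ∂(bayesPost π θ v x)) := by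
  have hI := integrable_exp_normSq (π := π) hθ hv x
  have hpos := integral_exp_pos hI
  have hI' := integrable_exp_normSq (π := π) hθ hv (x + h)
  have hpos' := integral_exp_pos hI'
  have hc : 0 < (√(2 * Real.pi * v))⁻¹ ^ n := by positivity
  have key (ω : Ω) : -normSq (x + h - θ ω) / (2 * v) =
      (-normSq h / (2 * v) - (∑ i, h i * (x i - μ i)) / v) +
        ((fun ω => -normSq (x - θ ω) / (2 * v)) + fun ω => (∑ i, h i * (θ ω i - μ i)) / v) ω := by
    simp only [Pi.add_apply, normSq, Pi.sub_apply]
    have : ∑ i, (x i + h i - θ ω i) ^ 2 = ∑ i, (x i - θ ω i) ^ 2 + ∑ i, h i ^ 2 +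
        2 * ∑ i, h i * (x i - μ i) - 2 * ∑ i, h i * (θ ω i - μ i) := by
      rw [Finset.mul_sum, Finset.mul_sum, ← Finset.sum_add_distrib, ← Finset.sum_add_distrib,
        ← Finset.sum_sub_distrib]
      exact Finset.sum_congr rfl fun i _ => by ring
    rw [this]
    field_simp
    ring
  have hprod : ∫ ω, Real.exp (-normSq (x + h - θ ω) / (2 * v)) ∂π =
      Real.exp (-normSq h / (2 * v) - (∑ i, h i * (x i - μ i)) / v) *
        ∫ ω, Real.exp (((fun ω => -normSq (x - θ ω) / (2 * v)) +
          fun ω => (∑ i, h i * (θ ω i - μ i)) / v) ω) ∂π := by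
    rw [← integral_const_mul]
    refine integral_congr_ae (ae_of_all _ fun ω => ?_)
    simp only
    rw [key, Real.exp_add]
  have hpos'' : 0 < ∫ ω, Real.exp (((fun ω => -normSq (x - θ ω) / (2 * v)) +
          fun ω => (∑ i, h i * (θ ω i - μ i)) / v) ω) ∂π := by
    rw [hprod] at hpos'
    exact pos_of_mul_pos_right hpos' (Real.exp_pos _).le
  rw [bayesPost, integral_exp_tilted, mixDens_eq, mixDens_eq, Real.log_mul hc.ne' hpos.ne',
    Real.log_mul hc.ne' hpos'.ne', hprod, Real.log_mul (Real.exp_pos _).ne' hpos''.ne',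
    Real.log_exp, Real.log_div hpos''.ne' hpos.ne', neg_div]
  ring

/-- The posterior mean. -/
noncomputable def postMean (π : Measure Ω) (θ : Ω → Fin n → ℝ) (v : ℝ) (x : Fin n → ℝ)
    (i : Fin n) : ℝ := ∫ ω, θ ω i ∂(bayesPost π θ v x)

lemma abs_postMean_le (hθ : Measurable θ) (hR : ∀ᵐ ω ∂π, ‖θ ω‖ ≤ R) (hv : 0 < v)
    (x : Fin n → ℝ) (i : Fin n) : |postMean π θ v x i| ≤ R := by
  have := isProbabilityMeasure_bayesPost (π := π) hθ hv x
  have h : ∀ᵐ ω ∂(bayesPost π θ v x), ‖θ ω i‖ ≤ R := ae_bayesPost_le hR x i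
  simpa [postMean] using norm_integral_le_of_norm_le_const h

lemma measurable_postMean (hθ : Measurable θ) (hv : 0 < v) (i : Fin n) :
    Measurable fun x => postMean π θ v x i :=
  measurable_integral_bayesPost (F := fun ω _ => θ ω i) hθ hv (by
    unfold Function.uncurry; fun_prop)

lemma measurable_postMean' (hθ : Measurable θ) (hv : 0 < v) : Measurable (postMean π θ v) :=
  measurable_pi_lambda _ fun i => measurable_postMean hθ hv i

/-- Averaging the log-density over a small Gaussian displacement of variance `t`: the second-order
term is governed by the posterior variance. -/
lemma le_integral_log_mixDens (hθ : Measurable θ) (hR : ∀ᵐ ω ∂π, ‖θ ω‖ ≤ R) (hv : 0 < v)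
    {t : ℝ} (ht : 0 < t) (x : Fin n → ℝ) :
    Real.log (mixDens π θ v x) - n * t / (2 * v) +
      t / (2 * v ^ 2) * ∫ ω, normSq (θ ω - postMean π θ v x) ∂(bayesPost π θ v x) -
      (n * (2 * R) / v) ^ 3 / 2 * (∫ z, ‖z‖ ^ 3 ∂(stdGauss n)) * (t * √t) -
      (n * (2 * R) / v) ^ 4 / 8 * (∫ z, ‖z‖ ^ 4 ∂(stdGauss n)) * t ^ 2 ≤
    ∫ z, Real.log (mixDens π θ v (x + √t • z)) ∂(stdGauss n) := by
  have hP := isProbabilityMeasure_bayesPost (π := π) hθ hv x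
  set P := bayesPost π θ v x with hPdef
  set μ := postMean π θ v x with hμ
  have hd (i : Fin n) : ∀ᵐ ω ∂P, |θ ω i - μ i| ≤ 2 * R := by
    filter_upwards [ae_bayesPost_le (v := v) hR x i] with ω hω
    have := abs_postMean_le hθ hR hv x i
    have h1 := abs_sub (θ ω i) (μ i)
    rw [← hμ] at this
    linarith
  have hR0 : 0 ≤ R := by
    obtain ⟨ω, hω⟩ := hR.exists
    exact (norm_nonneg _).trans hω
  have hdall : ∀ᵐ ω ∂P, ∀ i, |θ ω i - μ i| ≤ 2 * R := ae_all_iff.2 hd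
  have hsum (z : Fin n → ℝ) : ∀ᵐ ω ∂P, |∑ i, z i * (θ ω i - μ i)| ≤ n * (2 * R) * ‖z‖ := by
    filter_upwards [hdall] with ω hω
    calc |∑ i, z i * (θ ω i - μ i)| ≤ ∑ i, |z i * (θ ω i - μ i)| :=
          Finset.abs_sum_le_sum_abs _ _
      _ ≤ ∑ _i : Fin n, ‖z‖ * (2 * R) := by
          refine Finset.sum_le_sum fun i _ => ?_
          rw [abs_mul]
          exact mul_le_mul (norm_le_pi_norm z i) (hω i) (abs_nonneg _) (norm_nonneg _)
      _ = n * (2 * R) * ‖z‖ := by simp; ring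
  -- the swap of the two integrations over the displacement and the posterior
  have hswapI : Integrable (fun p : (Fin n → ℝ) × Ω => (∑ i, p.1 i * (θ p.2 i - μ i)) ^ 2)
      ((stdGauss n).prod P) := by
    have h2 : Integrable (fun p : (Fin n → ℝ) × Ω => (n * (2 * R)) ^ 2 * ‖p.1‖ ^ 2)
        ((stdGauss n).prod P) :=
      ((integrable_norm_pow_stdGauss n 2).comp_fst P).const_mul _
    refine h2.mono' (by fun_prop) ?_
    filter_upwards [Measure.quasiMeasurePreserving_snd.ae hdall] with p hp
    rw [norm_pow, ← mul_pow, Real.norm_eq_abs]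
    refine pow_le_pow_left₀ (abs_nonneg _) ?_ 2
    calc |∑ i, p.1 i * (θ p.2 i - μ i)| ≤ ∑ i, |p.1 i * (θ p.2 i - μ i)| :=
          Finset.abs_sum_le_sum_abs _ _
      _ ≤ ∑ _i : Fin n, ‖p.1‖ * (2 * R) := by
          refine Finset.sum_le_sum fun i _ => ?_
          rw [abs_mul]
          exact mul_le_mul (norm_le_pi_norm p.1 i) (hp i) (abs_nonneg _) (norm_nonneg _)
      _ = n * (2 * R) * ‖p.1‖ := by simp; ring
  have hswap : ∫ z, ∫ ω, (∑ i, z i * (θ ω i - μ i)) ^ 2 ∂P ∂(stdGauss n) =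
      ∫ ω, normSq (θ ω - μ) ∂P := by
    rw [integral_integral_swap hswapI]
    refine integral_congr_ae (ae_of_all _ fun ω => ?_)
    exact integral_sum_mul_sq_stdGauss (fun i => θ ω i - μ i)
  -- the pointwise bound
  have hpt (z : Fin n → ℝ) :
      Real.log (mixDens π θ v x) - t / (2 * v) * normSq z - √t / v * (∑ i, z i * (x i - μ i)) +
        t / (2 * v ^ 2) * ∫ ω, (∑ i, z i * (θ ω i - μ i)) ^ 2 ∂P -
        (n * (2 * R) / v) ^ 3 / 2 * (t * √t) * ‖z‖ ^ 3 -
        (n * (2 * R) / v) ^ 4 / 8 * t ^ 2 * ‖z‖ ^ 4 ≤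
      Real.log (mixDens π θ v (x + √t • z)) := by
    have hst : √t ^ 2 = t := Real.sq_sqrt ht.le
    rw [log_mixDens_add hθ hv x (√t • z) μ, normSq_smul, hst]
    have e1 (ω : Ω) : (∑ i, (√t • z) i * (θ ω i - μ i)) / v =
        √t / v * ∑ i, z i * (θ ω i - μ i) := by
      rw [Finset.sum_div, Finset.mul_sum]
      refine Finset.sum_congr rfl fun i _ => ?_
      simp only [Pi.smul_apply, smul_eq_mul]; ring
    have e2 : (∑ i, (√t • z) i * (x i - μ i)) / v = √t / v * ∑ i, z i * (x i - μ i) := by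
      rw [Finset.sum_div, Finset.mul_sum]
      refine Finset.sum_congr rfl fun i _ => ?_
      simp only [Pi.smul_apply, smul_eq_mul]; ring
    simp_rw [e1]
    rw [e2]
    have hIθ (i : Fin n) : Integrable (fun ω => θ ω i - μ i) P :=
      (integrable_const (2 * R)).mono' (by fun_prop) (hd i)
    have h0 : ∫ ω, √t / v * ∑ i, z i * (θ ω i - μ i) ∂P = 0 := by
      rw [integral_const_mul, integral_finsetSum _ fun i _ => (hIθ i).const_mul _]
      rw [Finset.sum_eq_zero, mul_zero]
      intro i _
      have hI2 : Integrable (fun ω => θ ω i) P :=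
        (integrable_const R).mono' (by fun_prop) (ae_bayesPost_le (v := v) hR x i)
      rw [integral_const_mul, integral_sub hI2 (integrable_const _)]
      simp [hμ, postMean, hPdef]
    have hk : ∀ᵐ ω ∂P, |√t / v * ∑ i, z i * (θ ω i - μ i)| ≤
        √t / v * (n * (2 * R) * ‖z‖) := by
      filter_upwards [hsum z] with ω hω
      rw [abs_mul, abs_of_nonneg (by positivity)]
      exact mul_le_mul_of_nonneg_left hω (by positivity)
    have h1 := le_log_integral_exp (by fun_prop) hk h0
    simp_rw [mul_pow (√t / v) (∑ i, z i * (θ _ i - μ i)) 2, integral_const_mul] at h1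
    have e3 : (√t / v * (n * (2 * R) * ‖z‖)) ^ 3 =
        (n * (2 * R) / v) ^ 3 * (t * √t) * ‖z‖ ^ 3 := by
      have : √t ^ 3 = t * √t := by rw [pow_succ, hst]
      rw [mul_pow, div_pow, this]; ring
    have e4 : (√t / v * (n * (2 * R) * ‖z‖)) ^ 4 =
        (n * (2 * R) / v) ^ 4 * t ^ 2 * ‖z‖ ^ 4 := by
      have : √t ^ 4 = t ^ 2 := by rw [show (4 : ℕ) = 2 * 2 from rfl, pow_mul, hst]
      rw [mul_pow, div_pow, this]; ring
    have e5 : (√t / v) ^ 2 = t / v ^ 2 := by rw [div_pow, hst]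
    rw [e3, e4, e5] at h1
    have e6 : t * normSq z / (2 * v) = t / (2 * v) * normSq z := by ring
    have e7 : ∀ r : ℝ, 1 / 2 * (t / v ^ 2 * r) = t / (2 * v ^ 2) * r := fun r => by
      field_simp
    rw [e7] at h1
    rw [e6]
    linarith
  obtain ⟨A, hA⟩ := exists_abs_log_mixDens_le hθ hR hv
  have hI0 : Integrable (fun z => Real.log (mixDens π θ v (x + √t • z))) (stdGauss n) :=
    integrable_comp_const_add_smul (measurable_log_mixDens hθ) hA x _
  have hJ1 := (integrable_normSq_stdGauss n).const_mul (t / (2 * v))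
  have hJ2 := (integrable_sum_mul_stdGauss (fun i => x i - μ i)).const_mul (√t / v)
  have hJ3 := hswapI.integral_prod_left.const_mul (t / (2 * v ^ 2))
  have hJ4 := (integrable_norm_pow_stdGauss n 3).const_mul
    ((n * (2 * R) / v) ^ 3 / 2 * (t * √t))
  have hJ5 := (integrable_norm_pow_stdGauss n 4).const_mul ((n * (2 * R) / v) ^ 4 / 8 * t ^ 2)
  have hJ0 : Integrable (fun _ : Fin n → ℝ => Real.log (mixDens π θ v x)) (stdGauss n) :=
    integrable_const _
  have hfin := integral_mono (((((hJ0.sub hJ1).sub hJ2).add hJ3).sub hJ4).sub hJ5) hI0 hpt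
  refine le_trans (le_of_eq ?_) hfin
  rw [integral_sub' ((((hJ0.sub hJ1).sub hJ2).add hJ3).sub hJ4) hJ5,
    integral_sub' (((hJ0.sub hJ1).sub hJ2).add hJ3) hJ4,
    integral_add' ((hJ0.sub hJ1).sub hJ2) hJ3,
    integral_sub' (hJ0.sub hJ1) hJ2, integral_sub' hJ0 hJ1]
  simp only [integral_const_mul, integral_normSq_stdGauss, integral_sum_mul_stdGauss, hswap]
  simp
  ring

end mixture

/-- Gibbs' inequality: an integrable function whose exponential has mean at most one has a
non-positive mean. -/
lemma integral_nonpos_of_lintegral_exp_le {α : Type*} [MeasurableSpace α] {P : Measure α}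
    [IsProbabilityMeasure P] {h : α → ℝ} (hi : Integrable h P)
    (he : ∫⁻ a, ENNReal.ofReal (Real.exp (h a)) ∂P ≤ 1) : ∫ a, h a ∂P ≤ 0 := by
  have hm : AEStronglyMeasurable (fun a => Real.exp (h a)) P :=
    Real.continuous_exp.comp_aestronglyMeasurable hi.1
  have hI : Integrable (fun a => Real.exp (h a)) P := by
    refine ⟨hm, ?_⟩
    rw [hasFiniteIntegral_iff_ofReal (ae_of_all _ fun a => (Real.exp_pos _).le)]
    exact he.trans_lt ENNReal.one_lt_top
  have h1 : ∫ a, Real.exp (h a) ∂P ≤ 1 := by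
    rw [integral_eq_lintegral_of_nonneg_ae (ae_of_all _ fun a => (Real.exp_pos _).le) hm]
    exact ENNReal.toReal_le_of_le_ofReal zero_le_one (by simpa using he)
  calc ∫ a, h a ∂P ≤ ∫ a, (Real.exp (h a) - 1) ∂P :=
        integral_mono hi (hI.sub (integrable_const _)) fun a => by
          have := Real.add_one_le_exp (h a)
          simp only; linarith
    _ = ∫ a, Real.exp (h a) ∂P - 1 := by
        rw [integral_sub hI (integrable_const _)]; simp
    _ ≤ 0 := by linarith

/-- The mean of the log-density of `θ + √v Z`, that is, minus its differential entropy. -/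
noncomputable def meanLog {Ω : Type*} [MeasurableSpace Ω] (π : Measure Ω) {n : ℕ}
    (θ : Ω → Fin n → ℝ) (v : ℝ) : ℝ :=
  ∫ p, Real.log (mixDens π θ v (θ p.1 + √v • p.2)) ∂(π.prod (stdGauss n))

/-- The Bayes mean squared error in estimating `θ` from `θ + √v Z`. -/
noncomputable def bayesMSE {Ω : Type*} [MeasurableSpace Ω] (π : Measure Ω) {n : ℕ}
    (θ : Ω → Fin n → ℝ) (v : ℝ) : ℝ :=
  ∫ p, normSq (θ p.1 - postMean π θ v (θ p.1 + √v • p.2)) ∂(π.prod (stdGauss n))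

section mixture

variable {Ω : Type*} [MeasurableSpace Ω] {π : Measure Ω} [IsProbabilityMeasure π] {n : ℕ}
  {θ : Ω → Fin n → ℝ} {R v : ℝ}

lemma lintegral_mixDens (hθ : Measurable θ) (hv : 0 < v) :
    ∫⁻ x, ENNReal.ofReal (mixDens π θ v x) = 1 := by
  have h := lintegral_obs (π := π) (F := fun _ _ => 1) hθ hv measurable_const
  simp only [mul_one, lintegral_const, measure_univ] at h
  rw [h]
  exact lintegral_congr fun x => (lintegral_gaussDens_sub hθ hv x).symm

lemma integrable_log_mixDens_comp (hθ : Measurable θ) (hR : ∀ᵐ ω ∂π, ‖θ ω‖ ≤ R) (hv : 0 < v)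
    (c : ℝ) : Integrable (fun p : Ω × (Fin n → ℝ) => Real.log (mixDens π θ v (θ p.1 + c • p.2)))
      (π.prod (stdGauss n)) := by
  obtain ⟨A, hA⟩ := exists_abs_log_mixDens_le hθ hR hv
  exact integrable_comp_add_smul (measurable_log_mixDens hθ) hA hθ hR c

/-- Among the mixture densities of all noise levels, the one of the noise level present has the
largest mean logarithm. -/
lemma integral_log_mixDens_le_meanLog (hθ : Measurable θ) (hR : ∀ᵐ ω ∂π, ‖θ ω‖ ≤ R) (hv : 0 < v)
    {w : ℝ} (hw : 0 < w) :
    ∫ p, Real.log (mixDens π θ v (θ p.1 + √w • p.2)) ∂(π.prod (stdGauss n)) ≤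
      meanLog π θ w := by
  have hi1 := integrable_log_mixDens_comp hθ hR hv (√w)
  have hi2 := integrable_log_mixDens_comp hθ hR hw (√w)
  rw [← sub_nonpos, meanLog, ← integral_sub hi1 hi2]
  refine integral_nonpos_of_lintegral_exp_le (hi1.sub hi2) (le_of_eq ?_)
  have h1 (p : Ω × (Fin n → ℝ)) : Real.exp (Real.log (mixDens π θ v (θ p.1 + √w • p.2)) -
      Real.log (mixDens π θ w (θ p.1 + √w • p.2))) =
      mixDens π θ v (θ p.1 + √w • p.2) / mixDens π θ w (θ p.1 + √w • p.2) := by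
    rw [Real.exp_sub, Real.exp_log (mixDens_pos hθ hv _), Real.exp_log (mixDens_pos hθ hw _)]
  simp_rw [h1]
  have hm : Measurable (Function.uncurry fun (_ : Ω) (x : Fin n → ℝ) =>
      ENNReal.ofReal (mixDens π θ v x / mixDens π θ w x)) :=
    (((measurable_mixDens hθ).div (measurable_mixDens hθ)).ennreal_ofReal).comp measurable_snd
  rw [lintegral_obs (F := fun _ x => ENNReal.ofReal (mixDens π θ v x / mixDens π θ w x)) hθ hw hm,
    ← lintegral_mixDens (π := π) hθ hv]
  refine lintegral_congr fun x => ?_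
  rw [lintegral_mul_const _ (by fun_prop), lintegral_gaussDens_sub hθ hw,
    ← ENNReal.ofReal_mul (mixDens_pos hθ hw x).le, mul_div_cancel₀ _ (mixDens_pos hθ hw x).ne']

lemma ae_normSq_sub_postMean_le (hθ : Measurable θ) (hR : ∀ᵐ ω ∂π, ‖θ ω‖ ≤ R) (hv : 0 < v) :
    ∀ᵐ ω ∂π, ∀ x, |normSq (θ ω - postMean π θ v x)| ≤ n * (2 * R) ^ 2 := by
  filter_upwards [hR] with ω hω x
  have hR0 : 0 ≤ R := (norm_nonneg _).trans hω
  rw [abs_of_nonneg (normSq_nonneg _)]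
  refine (normSq_le _).trans (mul_le_mul_of_nonneg_left ?_ (Nat.cast_nonneg n))
  refine pow_le_pow_left₀ (norm_nonneg _) ((norm_sub_le _ _).trans ?_) 2
  have : ‖postMean π θ v x‖ ≤ R :=
    (pi_norm_le_iff_of_nonneg hR0).2 fun i => abs_postMean_le hθ hR hv x i
  linarith

/-- Comparison of the entropies at noise levels `v` and `v + t`, to first order in `t`. -/
lemma meanLog_sub_le (hθ : Measurable θ) (hR : ∀ᵐ ω ∂π, ‖θ ω‖ ≤ R) (hv : 0 < v)
    {t : ℝ} (ht : 0 < t) :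
    meanLog π θ v - meanLog π θ (v + t) ≤
      n * t / (2 * v) - t / (2 * v ^ 2) * bayesMSE π θ v +
      (n * (2 * R) / v) ^ 3 / 2 * (∫ z, ‖z‖ ^ 3 ∂(stdGauss n)) * (t * √t) +
      (n * (2 * R) / v) ^ 4 / 8 * (∫ z, ‖z‖ ^ 4 ∂(stdGauss n)) * t ^ 2 := by
  obtain ⟨A, hA⟩ := exists_abs_log_mixDens_le hθ hR hv
  have hm := measurable_log_mixDens (π := π) (v := v) hθ
  have hsq : √v ^ 2 + √t ^ 2 = √(v + t) ^ 2 := by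
    rw [Real.sq_sqrt hv.le, Real.sq_sqrt ht.le, Real.sq_sqrt (by linarith)]
  obtain ⟨hHi, e1⟩ := integral_comp_add_smul_add_smul hm hA hθ hR hsq
  have h1 := integral_log_mixDens_le_meanLog hθ hR hv (w := v + t) (by linarith)
  rw [← e1] at h1
  have hFm : Measurable (Function.uncurry fun (ω : Ω) (x : Fin n → ℝ) =>
      normSq (θ ω - postMean π θ v x)) := by
    have := measurable_postMean' (π := π) hθ hv
    unfold Function.uncurry; fun_prop
  have e2 := integral_integral_bayesPost (π := π) hθ hv hFm
    (ae_normSq_sub_postMean_le hθ hR hv)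
  have hVm := measurable_integral_bayesPost (π := π) hθ hv hFm
  have hVi : Integrable (fun p : Ω × (Fin n → ℝ) =>
      ∫ ω, normSq (θ ω - postMean π θ v (θ p.1 + √v • p.2))
        ∂(bayesPost π θ v (θ p.1 + √v • p.2))) (π.prod (stdGauss n)) := by
    refine (integrable_const (n * (2 * R) ^ 2)).mono'
      (hVm.comp (show Measurable fun p : Ω × (Fin n → ℝ) => θ p.1 + √v • p.2 by
        fun_prop)).aestronglyMeasurable (ae_of_all _ fun p => ?_)
    have := isProbabilityMeasure_bayesPost (π := π) hθ hv (θ p.1 + √v • p.2)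
    have hK : ∀ᵐ ω ∂(bayesPost π θ v (θ p.1 + √v • p.2)),
        ‖normSq (θ ω - postMean π θ v (θ p.1 + √v • p.2))‖ ≤ n * (2 * R) ^ 2 := by
      filter_upwards [(tilted_absolutelyContinuous π _).ae_le
        (ae_normSq_sub_postMean_le hθ hR hv)] with ω hω using hω _
    simpa using norm_integral_le_of_norm_le_const hK
  have hLi := integrable_log_mixDens_comp hθ hR hv (√v)
  set c1 := n * t / (2 * v)
  set c2 := t / (2 * v ^ 2)
  set c3 := (n * (2 * R) / v) ^ 3 / 2 * (∫ z, ‖z‖ ^ 3 ∂(stdGauss n)) * (t * √t)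
  set c4 := (n * (2 * R) / v) ^ 4 / 8 * (∫ z, ‖z‖ ^ 4 ∂(stdGauss n)) * t ^ 2
  have hK (c : ℝ) : Integrable (fun _ : Ω × (Fin n → ℝ) => c) (π.prod (stdGauss n)) :=
    integrable_const c
  have h2 := integral_mono (((((hLi.sub (hK c1)).add (hVi.const_mul c2)).sub (hK c3)).sub (hK c4)))
    hHi (fun p => le_integral_log_mixDens hθ hR hv ht (θ p.1 + √v • p.2))
  rw [integral_sub' (((hLi.sub (hK c1)).add (hVi.const_mul c2)).sub (hK c3)) (hK c4),
    integral_sub' ((hLi.sub (hK c1)).add (hVi.const_mul c2)) (hK c3),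
    integral_add' (hLi.sub (hK c1)) (hVi.const_mul c2), integral_sub' hLi (hK c1),
    integral_const_mul, ← e2] at h2
  simp only [integral_const, probReal_univ, one_smul] at h2
  unfold meanLog bayesMSE at *
  linarith

end mixture

/-- A function on `[u, w]` whose increments are bounded below by `-o(t)` is non-decreasing from
`u` to `w`. -/
lemma le_of_forall_sub_add_le {D : ℝ → ℝ} {u w c c' : ℝ} (huw : u ≤ w)
    (h : ∀ v t, u ≤ v → 0 < t → D v - D (v + t) ≤ c * (t * √t) + c' * t ^ 2) : D u ≤ D w := by
  rcases huw.eq_or_lt with rfl | huw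
  · exact le_rfl
  set δ := w - u with hδ
  have hδ0 : 0 < δ := sub_pos.2 huw
  have hN (N : ℕ) : D u - D w ≤ δ * (c * √(δ / (N + 1)) + c' * (δ / (N + 1))) := by
    set t := δ / (N + 1) with ht
    have hNp : (0 : ℝ) < N + 1 := by positivity
    have ht0 : 0 < t := by positivity
    have hk (k : ℕ) : D u - D (u + k * t) ≤ k * (c * (t * √t) + c' * t ^ 2) := by
      induction k with
      | zero => simp
      | succ k ih =>
        have h1 := h (u + k * t) t (by nlinarith [Nat.cast_nonneg (α := ℝ) k]) ht0
        push_cast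
        rw [show u + (k + 1) * t = u + k * t + t by ring]
        linarith
    have h1 := hk (N + 1)
    push_cast at h1
    have h2 : (N + 1) * t = δ := by rw [ht]; field_simp
    rw [h2, show u + δ = w by rw [hδ]; ring] at h1
    refine h1.trans (le_of_eq ?_)
    rw [← h2]; ring
  have ht : Tendsto (fun N : ℕ => δ / ((N : ℝ) + 1)) atTop (nhds 0) :=
    tendsto_const_div_atTop_nhds_zero_nat δ |>.comp (tendsto_add_atTop_nat 1) |>.congr fun N => by
      simp
  have hlim : Tendsto (fun N : ℕ => δ * (c * √(δ / (N + 1)) + c' * (δ / (N + 1)))) atTop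
      (nhds (δ * (c * √0 + c' * 0))) :=
    (((Real.continuous_sqrt.tendsto 0).comp ht).const_mul c |>.add (ht.const_mul c')).const_mul δ
  have := ge_of_tendsto' hlim hN
  simp at this
  linarith

/-- If `θ` is at least as hard to estimate as a Gaussian vector with variances `sᵢ²`, at every
noise level, then its entropy increases with the noise at most as fast as that of the Gaussian
vector. -/
lemma meanLog_sub_meanLog_le {Ω : Type*} [MeasurableSpace Ω] {π : Measure Ω}
    [IsProbabilityMeasure π] {n : ℕ} {θ : Ω → Fin n → ℝ} {R u w : ℝ} (hθ : Measurable θ)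
    (hR : ∀ᵐ ω ∂π, ‖θ ω‖ ≤ R) (hu : 0 < u) (huw : u ≤ w) (s : Fin n → ℝ)
    (hmse : ∀ v, 0 < v → ∑ i, v * s i ^ 2 / (v + s i ^ 2) ≤ bayesMSE π θ v) :
    meanLog π θ u - meanLog π θ w ≤
      1 / 2 * ∑ i, Real.log ((w + s i ^ 2) / (u + s i ^ 2)) := by
  have hR0 : 0 ≤ R := by
    obtain ⟨ω, hω⟩ := hR.exists
    exact (norm_nonneg _).trans hω
  set M3 := ∫ z, ‖z‖ ^ 3 ∂(stdGauss n) with hM3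
  set M4 := ∫ z, ‖z‖ ^ 4 ∂(stdGauss n) with hM4
  have hM3' : 0 ≤ M3 := integral_nonneg fun z => by positivity
  have hM4' : 0 ≤ M4 := integral_nonneg fun z => by positivity
  set D : ℝ → ℝ := fun v => meanLog π θ v + 1 / 2 * ∑ i, Real.log (v + s i ^ 2) with hD
  have key : D u ≤ D w := by
    refine le_of_forall_sub_add_le (c := (n * (2 * R) / u) ^ 3 / 2 * M3)
      (c' := (n * (2 * R) / u) ^ 4 / 8 * M4 + n / (2 * u ^ 2)) huw fun v t huv ht => ?_
    have hv : 0 < v := hu.trans_le huv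
    have h1 := meanLog_sub_le hθ hR hv ht
    have h2 : t / (2 * v ^ 2) * ∑ i, v * s i ^ 2 / (v + s i ^ 2) ≤
        t / (2 * v ^ 2) * bayesMSE π θ v :=
      mul_le_mul_of_nonneg_left (hmse v hv) (by positivity)
    have hq : n * (2 * R) / v ≤ n * (2 * R) / u :=
      div_le_div_of_nonneg_left (by positivity) hu huv
    have h3 : (n * (2 * R) / v) ^ 3 / 2 * M3 * (t * √t) ≤
        (n * (2 * R) / u) ^ 3 / 2 * M3 * (t * √t) := by
      have : (n * (2 * R) / v) ^ 3 ≤ (n * (2 * R) / u) ^ 3 :=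
        pow_le_pow_left₀ (by positivity) hq 3
      gcongr
    have h4 : (n * (2 * R) / v) ^ 4 / 8 * M4 * t ^ 2 ≤
        (n * (2 * R) / u) ^ 4 / 8 * M4 * t ^ 2 := by
      have : (n * (2 * R) / v) ^ 4 ≤ (n * (2 * R) / u) ^ 4 :=
        pow_le_pow_left₀ (by positivity) hq 4
      gcongr
    have hi (i : Fin n) : t / (2 * v) - t / (2 * v ^ 2) * (v * s i ^ 2 / (v + s i ^ 2)) -
        t ^ 2 / (2 * u ^ 2) ≤
        1 / 2 * (Real.log (v + t + s i ^ 2) - Real.log (v + s i ^ 2)) := by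
      set q := v + s i ^ 2 with hq
      have hq0 : 0 < q := by positivity
      have hvq : v ≤ q := by nlinarith [sq_nonneg (s i)]
      have e1 : t / (2 * v) - t / (2 * v ^ 2) * (v * s i ^ 2 / q) = 1 / 2 * (t / q) := by
        rw [show s i ^ 2 = q - v by rw [hq]; ring]
        field_simp
        ring
      have e2 : Real.log (v + t + s i ^ 2) - Real.log q = Real.log (1 + t / q) := by
        rw [← Real.log_div (by positivity) hq0.ne']
        congr 1
        field_simp
        rw [hq]; ring
      have h5 := Real.le_log_one_add_of_nonneg (x := t / q) (by positivity)
      have h6 : t / q - (t / q) ^ 2 / 2 ≤ 2 * (t / q) / (t / q + 2) := by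
        have : 0 < t / q := by positivity
        rw [le_div_iff₀ (by linarith)]
        nlinarith [mul_pos this (mul_pos this this)]
      have h7 : t / q ≤ t / u := div_le_div_of_nonneg_left ht.le hu (huv.trans hvq)
      have h8 : (t / q) ^ 2 ≤ (t / u) ^ 2 := pow_le_pow_left₀ (by positivity) h7 2
      have h9 : t ^ 2 / (2 * u ^ 2) = (t / u) ^ 2 / 2 := by rw [div_pow]; field_simp
      rw [e1, e2, h9]
      nlinarith [sq_nonneg (t / u)]
    have hsum := Finset.sum_le_sum fun i (_ : i ∈ Finset.univ) => hi i
    simp only [Finset.sum_sub_distrib, ← Finset.mul_sum, Finset.sum_const, Finset.card_univ,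
      Fintype.card_fin, nsmul_eq_mul] at hsum
    have e5 : (n : ℝ) * (t / (2 * v)) = n * t / (2 * v) := by ring
    have e6 : (n : ℝ) * (t ^ 2 / (2 * u ^ 2)) = n / (2 * u ^ 2) * t ^ 2 := by ring
    rw [e5, e6] at hsum
    simp only [hD]
    linarith
  have hlog (i : Fin n) : Real.log ((w + s i ^ 2) / (u + s i ^ 2)) =
      Real.log (w + s i ^ 2) - Real.log (u + s i ^ 2) := by
    have : 0 < w := hu.trans_le huw
    rw [Real.log_div (by positivity) (by positivity)]
  simp_rw [hlog, Finset.sum_sub_distrib]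
  simp only [hD] at key
  linarith

/-! ### The average Kullback-Leibler risk under a prior -/

lemma ofReal_integral_le_lintegral_ofReal {α : Type*} [MeasurableSpace α] {μ : Measure α}
    {f : α → ℝ} (hf : Integrable f μ) :
    ENNReal.ofReal (∫ a, f a ∂μ) ≤ ∫⁻ a, ENNReal.ofReal (f a) ∂μ := by
  rw [integral_eq_lintegral_pos_part_sub_lintegral_neg_part hf]
  have h : ∫⁻ a, ENNReal.ofReal (f a) ∂μ ≠ ∞ :=
    (lintegral_ofReal_le_lintegral_enorm f |>.trans_lt hf.2).ne
  refine ENNReal.ofReal_le_of_le_toReal ?_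
  linarith [ENNReal.toReal_nonneg (a := ∫⁻ a, ENNReal.ofReal (-f a) ∂μ)]

/-- A variational lower bound for the Kullback-Leibler divergence. -/
lemma ofReal_integral_add_one_le_klDiv {α : Type*} [MeasurableSpace α] {μ ν : Measure α}
    [IsProbabilityMeasure μ] [IsProbabilityMeasure ν] {f : α → ℝ} (hf : Integrable f μ)
    (hfm : Measurable f) :
    ENNReal.ofReal (∫ a, f a ∂μ + 1) ≤
      klDiv μ ν + ∫⁻ a, ENNReal.ofReal (Real.exp (f a)) ∂ν := by
  by_cases hkl : klDiv μ ν = ∞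
  · simp [hkl]
  by_cases hE : ∫⁻ a, ENNReal.ofReal (Real.exp (f a)) ∂ν = ∞
  · simp [hE]
  obtain ⟨hac, hllr⟩ := klDiv_ne_top_iff.1 hkl
  have hkle : klDiv μ ν = ENNReal.ofReal (∫ a, llr μ ν a ∂μ) := by
    rw [klDiv_of_ac_of_integrable hac hllr]; simp
  have hm : AEStronglyMeasurable (fun a => Real.exp (f a - llr μ ν a)) μ :=
    Real.continuous_exp.comp_aestronglyMeasurable (hf.sub hllr).1
  have hle : ∫⁻ a, ENNReal.ofReal (Real.exp (f a - llr μ ν a)) ∂μ ≤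
      ∫⁻ a, ENNReal.ofReal (Real.exp (f a)) ∂ν := by
    have hmm : Measurable fun a => ENNReal.ofReal (Real.exp (f a - llr μ ν a)) := by
      have := measurable_llr μ ν
      fun_prop
    rw [← lintegral_rnDeriv_mul hac hmm.aemeasurable]
    refine lintegral_mono_ae ?_
    filter_upwards [μ.rnDeriv_lt_top ν] with a ha
    rcases eq_or_ne (μ.rnDeriv ν a) 0 with h0 | h0
    · simp [h0]
    · have hpos : 0 < (μ.rnDeriv ν a).toReal := ENNReal.toReal_pos h0 ha.ne
      rw [Real.exp_sub, llr, Real.exp_log hpos, ENNReal.ofReal_div_of_pos hpos,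
        ENNReal.ofReal_toReal ha.ne, ENNReal.mul_div_cancel h0 ha.ne]
  have hI : Integrable (fun a => Real.exp (f a - llr μ ν a)) μ := by
    refine ⟨hm, ?_⟩
    rw [hasFiniteIntegral_iff_ofReal (ae_of_all _ fun a => (Real.exp_pos _).le)]
    exact hle.trans_lt (lt_top_iff_ne_top.2 hE)
  have h1 : ∫ a, f a ∂μ - ∫ a, llr μ ν a ∂μ ≤ ∫ a, Real.exp (f a - llr μ ν a) ∂μ - 1 := by
    rw [← integral_sub hf hllr]
    calc _ ≤ ∫ a, (Real.exp (f a - llr μ ν a) - 1) ∂μ :=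
          integral_mono (hf.sub hllr) (hI.sub (integrable_const _)) fun a => by
            have := Real.add_one_le_exp (f a - llr μ ν a)
            simp only [Pi.sub_apply]; linarith
      _ = _ := by rw [integral_sub hI (integrable_const _)]; simp
  calc ENNReal.ofReal (∫ a, f a ∂μ + 1)
      ≤ ENNReal.ofReal (∫ a, llr μ ν a ∂μ + ∫ a, Real.exp (f a - llr μ ν a) ∂μ) :=
        ENNReal.ofReal_le_ofReal (by linarith)
    _ ≤ ENNReal.ofReal (∫ a, llr μ ν a ∂μ) +
        ENNReal.ofReal (∫ a, Real.exp (f a - llr μ ν a) ∂μ) := ENNReal.ofReal_add_le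
    _ ≤ _ := by
        rw [hkle]
        gcongr
        rwa [ofReal_integral_eq_lintegral_ofReal hI (ae_of_all _ fun a => (Real.exp_pos _).le)]

lemma log_gaussDens {n : ℕ} {v : ℝ} (hv : 0 < v) (x : Fin n → ℝ) :
    Real.log (gaussDens v x) = -(n / 2 * Real.log (2 * Real.pi * v)) - normSq x / (2 * v) := by
  rw [gaussDens, Real.log_mul (by positivity) (Real.exp_pos _).ne', Real.log_exp, Real.log_pow,
    Real.log_inv, Real.log_sqrt (by positivity)]
  ring

lemma exists_abs_log_gaussDens_le {n : ℕ} {v : ℝ} (hv : 0 < v) :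
    ∃ A : ℝ, ∀ x : Fin n → ℝ, |Real.log (gaussDens v x)| ≤ A * (1 + ‖x‖ ^ 2) := by
  refine ⟨|n / 2 * Real.log (2 * Real.pi * v)| + n / (2 * v), fun x => ?_⟩
  rw [log_gaussDens hv]
  refine (abs_sub _ _).trans ?_
  rw [abs_neg, abs_of_nonneg (a := normSq x / (2 * v))
    (div_nonneg (normSq_nonneg x) (by positivity))]
  have h1 : normSq x / (2 * v) ≤ n / (2 * v) * ‖x‖ ^ 2 := by
    rw [div_mul_eq_mul_div]
    exact div_le_div_of_nonneg_right (normSq_le x) (by positivity)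
  have h2 := abs_nonneg (n / 2 * Real.log (2 * Real.pi * v))
  have h3 : 0 ≤ (n : ℝ) / (2 * v) := by positivity
  nlinarith [mul_nonneg h2 (sq_nonneg ‖x‖)]

lemma measurable_log_gaussDens {n : ℕ} {v : ℝ} :
    Measurable fun x : Fin n → ℝ => Real.log (gaussDens v x) :=
  Real.measurable_log.comp (measurable_gaussDens v)

lemma integral_log_gaussDens {n : ℕ} {v : ℝ} (hv : 0 < v) :
    ∫ z : Fin n → ℝ, Real.log (gaussDens v (√v • z)) ∂(stdGauss n) =
      -(n / 2 * Real.log (2 * Real.pi * v)) - n / 2 := by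
  have h (z : Fin n → ℝ) : Real.log (gaussDens v (√v • z)) =
      -(n / 2 * Real.log (2 * Real.pi * v)) - 1 / 2 * normSq z := by
    rw [log_gaussDens hv, normSq_smul, Real.sq_sqrt hv.le]
    field_simp
  simp_rw [h]
  rw [integral_sub (integrable_const _) ((integrable_normSq_stdGauss n).const_mul _),
    integral_const_mul, integral_normSq_stdGauss]
  simp
  ring

/-- Two independent observations of the same centre amount to their difference, which carries no
information, and their precision-weighted mean. -/
lemma gaussDens_mul_gaussDens {n : ℕ} {v w : ℝ} (hv : 0 < v) (hw : 0 < w) (x y θ : Fin n → ℝ) :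
    gaussDens w (x - θ) * gaussDens v (y - θ) = gaussDens (w + v) (x - y) *
      gaussDens (w * v / (w + v)) ((v / (w + v)) • x + (w / (w + v)) • y - θ) := by
  have hwv : 0 < w + v := by positivity
  have hu : 0 < w * v / (w + v) := by positivity
  have e : Real.log (gaussDens w (x - θ) * gaussDens v (y - θ)) =
      Real.log (gaussDens (w + v) (x - y) *
      gaussDens (w * v / (w + v)) ((v / (w + v)) • x + (w / (w + v)) • y - θ)) := by
    rw [Real.log_mul (gaussDens_pos hw _).ne' (gaussDens_pos hv _).ne',
      Real.log_mul (gaussDens_pos hwv _).ne' (gaussDens_pos hu _).ne',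
      log_gaussDens hw, log_gaussDens hv, log_gaussDens hwv, log_gaussDens hu]
    have h2 : Real.log (2 * Real.pi * (w * v / (w + v))) = Real.log (2 * Real.pi * w) +
        Real.log (2 * Real.pi * v) - Real.log (2 * Real.pi * (w + v)) := by
      rw [← Real.log_mul (by positivity) (by positivity),
        ← Real.log_div (by positivity) (by positivity)]
      congr 1
      field_simp
    have h3 : normSq (x - θ) / (2 * w) + normSq (y - θ) / (2 * v) =
        normSq (x - y) / (2 * (w + v)) +
        normSq ((v / (w + v)) • x + (w / (w + v)) • y - θ) / (2 * (w * v / (w + v))) := by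
      simp only [normSq, Finset.sum_div]
      rw [← Finset.sum_add_distrib, ← Finset.sum_add_distrib]
      refine Finset.sum_congr rfl fun i _ => ?_
      simp only [Pi.sub_apply, Pi.add_apply, Pi.smul_apply, smul_eq_mul]
      field_simp
      ring
    rw [h2]
    linarith
  exact Real.log_injOn_pos (mul_pos (gaussDens_pos hw _) (gaussDens_pos hv _))
    (mul_pos (gaussDens_pos hwv _) (gaussDens_pos hu _)) e

/-- The log-likelihood ratio of the true density `N(θ, v Iₙ)` to the Bayes predictive density, at
the point `y`, given the observation `x` of noise variance `w`. -/
noncomputable def predLLR {Ω : Type*} [MeasurableSpace Ω] (π : Measure Ω) {n : ℕ}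
    (θ : Ω → Fin n → ℝ) (w v : ℝ) (ω : Ω) (x y : Fin n → ℝ) : ℝ :=
  Real.log (gaussDens v (y - θ ω)) - Real.log (gaussDens (w + v) (x - y)) -
    Real.log (mixDens π θ (w * v / (w + v)) ((v / (w + v)) • x + (w / (w + v)) • y)) +
    Real.log (mixDens π θ w x)

lemma predLLR_obs {Ω : Type*} [MeasurableSpace Ω] {π : Measure Ω} {n : ℕ}
    {θ : Ω → Fin n → ℝ} {w v : ℝ} (hw : 0 < w) (hv : 0 < v) (ω : Ω) (z z' : Fin n → ℝ) :
    predLLR π θ w v ω (θ ω + √w • z) (θ ω + √v • z') =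
      Real.log (gaussDens v ((0 : Fin n → ℝ) + (0 : ℝ) • z + √v • z')) -
      Real.log (gaussDens (w + v) ((0 : Fin n → ℝ) + √w • z + (-√v) • z')) -
      Real.log (mixDens π θ (w * v / (w + v))
        (θ ω + (v / (w + v) * √w) • z + (w / (w + v) * √v) • z')) +
      Real.log (mixDens π θ w (θ ω + √w • z + (0 : ℝ) • z')) := by
  have hwv : w + v ≠ 0 := by positivity
  have e1 : θ ω + √v • z' - θ ω = (0 : Fin n → ℝ) + (0 : ℝ) • z + √v • z' := by simp
  have e2 : θ ω + √w • z - (θ ω + √v • z') = (0 : Fin n → ℝ) + √w • z + (-√v) • z' := by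
    ext i; simp; ring
  have e3 : (v / (w + v)) • (θ ω + √w • z) + (w / (w + v)) • (θ ω + √v • z') =
      θ ω + (v / (w + v) * √w) • z + (w / (w + v) * √v) • z' := by
    ext i
    simp only [Pi.add_apply, Pi.smul_apply, smul_eq_mul]
    field_simp
    ring
  have e4 : θ ω + √w • z + (0 : ℝ) • z' = θ ω + √w • z := by simp
  rw [predLLR, e1, e2, e3, e4]

section mixture

variable {Ω : Type*} [MeasurableSpace Ω] {π : Measure Ω} [IsProbabilityMeasure π] {n : ℕ}
  {θ : Ω → Fin n → ℝ} {R w v : ℝ}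

lemma measurable_predLLR (hθ : Measurable θ) :
    Measurable fun q : Ω × (Fin n → ℝ) × (Fin n → ℝ) => predLLR π θ w v q.1 q.2.1 q.2.2 := by
  have h1 := measurable_log_mixDens (π := π) (v := w) hθ
  have h2 := measurable_log_mixDens (π := π) (v := w * v / (w + v)) hθ
  have h3 := measurable_log_gaussDens (n := n) (v := v)
  have h4 := measurable_log_gaussDens (n := n) (v := w + v)
  unfold predLLR
  refine ((Measurable.sub ?_ ?_).sub ?_).add ?_
  · exact h3.comp (by fun_prop)
  · exact h4.comp (by fun_prop)
  · exact h2.comp (by fun_prop)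
  · exact h1.comp (by fun_prop)

/-- The mean of the log-likelihood ratio to the Bayes predictive density. -/
lemma integral_predLLR (hθ : Measurable θ) (hR : ∀ᵐ ω ∂π, ‖θ ω‖ ≤ R) (hw : 0 < w) (hv : 0 < v) :
    (∀ ω z, Integrable (fun z' => predLLR π θ w v ω (θ ω + √w • z) (θ ω + √v • z'))
      (stdGauss n)) ∧
    Integrable (fun p : Ω × (Fin n → ℝ) =>
      ∫ z', predLLR π θ w v p.1 (θ p.1 + √w • p.2) (θ p.1 + √v • z') ∂(stdGauss n))
      (π.prod (stdGauss n)) ∧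
    ∫ p, ∫ z', predLLR π θ w v p.1 (θ p.1 + √w • p.2) (θ p.1 + √v • z') ∂(stdGauss n)
      ∂(π.prod (stdGauss n)) =
      n / 2 * Real.log ((w + v) / v) + meanLog π θ w - meanLog π θ (w * v / (w + v)) := by
  have hwv : 0 < w + v := by positivity
  have hu : 0 < w * v / (w + v) := by positivity
  obtain ⟨A1, hA1⟩ := exists_abs_log_gaussDens_le (n := n) hv
  obtain ⟨A2, hA2⟩ := exists_abs_log_gaussDens_le (n := n) hwv
  obtain ⟨A3, hA3⟩ := exists_abs_log_mixDens_le hθ hR hu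
  obtain ⟨A4, hA4⟩ := exists_abs_log_mixDens_le hθ hR hw
  have m1 := measurable_log_gaussDens (n := n) (v := v)
  have m2 := measurable_log_gaussDens (n := n) (v := w + v)
  have m3 := measurable_log_mixDens (π := π) (v := w * v / (w + v)) hθ
  have m4 := measurable_log_mixDens (π := π) (v := w) hθ
  have sw := Real.sq_sqrt hw.le
  have sv := Real.sq_sqrt hv.le
  obtain ⟨I1, J1⟩ := integral_comp_add_smul_add_smul (π := π) (θ := fun _ => 0) (R := 0)
    (a := 0) (b := √v) (c := √v) m1 hA1 measurable_const (by simp) (by simp)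
  obtain ⟨I2, J2⟩ := integral_comp_add_smul_add_smul (π := π) (θ := fun _ => 0) (R := 0)
    (a := √w) (b := -√v) (c := √(w + v)) m2 hA2 measurable_const (by simp)
    (by rw [neg_sq, sw, sv, Real.sq_sqrt hwv.le])
  obtain ⟨I3, J3⟩ := integral_comp_add_smul_add_smul (π := π) (θ := θ) (R := R)
    (a := v / (w + v) * √w) (b := w / (w + v) * √v) (c := √(w * v / (w + v))) m3 hA3 hθ hR
    (by rw [mul_pow, mul_pow, sw, sv, Real.sq_sqrt hu.le]; field_simp; ring)
  obtain ⟨I4, J4⟩ := integral_comp_add_smul_add_smul (π := π) (θ := θ) (R := R)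
    (a := √w) (b := 0) (c := √w) m4 hA4 hθ hR (by simp)
  have K1 (z : Fin n → ℝ) := integrable_comp_const_add_smul m1 hA1
    ((0 : Fin n → ℝ) + (0 : ℝ) • z) (√v)
  have K2 (z : Fin n → ℝ) := integrable_comp_const_add_smul m2 hA2
    ((0 : Fin n → ℝ) + √w • z) (-√v)
  have K3 (ω : Ω) (z : Fin n → ℝ) := integrable_comp_const_add_smul m3 hA3
    (θ ω + (v / (w + v) * √w) • z) (w / (w + v) * √v)
  have K4 (ω : Ω) (z : Fin n → ℝ) := integrable_comp_const_add_smul m4 hA4 (θ ω + √w • z) 0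
  have split (p : Ω × (Fin n → ℝ)) :
      ∫ z', predLLR π θ w v p.1 (θ p.1 + √w • p.2) (θ p.1 + √v • z') ∂(stdGauss n) =
      ∫ z', Real.log (gaussDens v ((0 : Fin n → ℝ) + (0 : ℝ) • p.2 + √v • z')) ∂(stdGauss n) -
      ∫ z', Real.log (gaussDens (w + v) ((0 : Fin n → ℝ) + √w • p.2 + (-√v) • z'))
        ∂(stdGauss n) -
      ∫ z', Real.log (mixDens π θ (w * v / (w + v))
        (θ p.1 + (v / (w + v) * √w) • p.2 + (w / (w + v) * √v) • z')) ∂(stdGauss n) +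
      ∫ z', Real.log (mixDens π θ w (θ p.1 + √w • p.2 + (0 : ℝ) • z')) ∂(stdGauss n) := by
    simp_rw [predLLR_obs hw hv]
    have e := integral_add' (((K1 p.2).sub (K2 p.2)).sub (K3 p.1 p.2)) (K4 p.1 p.2)
    rw [integral_sub' ((K1 p.2).sub (K2 p.2)) (K3 p.1 p.2), integral_sub' (K1 p.2) (K2 p.2)] at e
    exact e
  refine ⟨fun ω z => ?_, ?_, ?_⟩
  · simp_rw [predLLR_obs hw hv]
    exact (((K1 z).sub (K2 z)).sub (K3 ω z)).add (K4 ω z)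
  · simp_rw [split]
    exact ((I1.sub I2).sub I3).add I4
  · simp_rw [split]
    have e := integral_add' ((I1.sub I2).sub I3) I4
    rw [integral_sub' (I1.sub I2) I3, integral_sub' I1 I2, J1, J2, J3, J4] at e
    refine Eq.trans e ?_
    have c1 : ∫ p : Ω × (Fin n → ℝ), Real.log (gaussDens v (0 + √v • p.2))
        ∂(π.prod (stdGauss n)) = -(n / 2 * Real.log (2 * Real.pi * v)) - n / 2 := by
      rw [← integral_log_gaussDens hv, integral_fun_snd (fun z : Fin n → ℝ =>
        Real.log (gaussDens v (0 + √v • z)))]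
      simp
    have c2 : ∫ p : Ω × (Fin n → ℝ), Real.log (gaussDens (w + v) (0 + √(w + v) • p.2))
        ∂(π.prod (stdGauss n)) = -(n / 2 * Real.log (2 * Real.pi * (w + v))) - n / 2 := by
      rw [← integral_log_gaussDens hwv, integral_fun_snd (fun z : Fin n → ℝ =>
        Real.log (gaussDens (w + v) (0 + √(w + v) • z)))]
      simp
    have c3 : Real.log ((w + v) / v) = Real.log (2 * Real.pi * (w + v)) -
        Real.log (2 * Real.pi * v) := by
      rw [← Real.log_div (by positivity) (by positivity)]
      congr 1
      field_simp
    rw [c1, c2, c3, meanLog, meanLog]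
    ring

lemma lintegral_gaussianVec {v : ℝ≥0} (f : (Fin n → ℝ) → ℝ≥0∞) (hv : v ≠ 0)
    (y : Fin n → ℝ) :
    ∫⁻ x, f x ∂(gaussianVec y v) = ∫⁻ z, f (y + √v • z) ∂(stdGauss n) := by
  have hs : √(v : ℝ) ≠ 0 := by
    have : (0 : ℝ) < v := by exact_mod_cast pos_iff_ne_zero.2 hv
    positivity
  rw [gaussianVec_eq_map]
  exact ((measurableEmbedding_addLeft y).comp (measurableEmbedding_const_smul₀ hs)).lintegral_map f

instance isProbabilityMeasure_law (p : PredictiveDensity n) (x : Fin n → ℝ) :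
    IsProbabilityMeasure (p.law x) :=
  ⟨by rw [PredictiveDensity.law, withDensity_apply _ MeasurableSet.univ, Measure.restrict_univ,
    p.lintegral_dens]⟩

lemma measurable_dens_ofReal (p : PredictiveDensity n) (x : Fin n → ℝ) :
    Measurable fun y => ENNReal.ofReal (p.dens x y) :=
  p.measurable_dens.ennreal_ofReal.comp measurable_prodMk_left

lemma measurable_exp_predLLR (hθ : Measurable θ) :
    Measurable fun q : Ω × (Fin n → ℝ) × (Fin n → ℝ) =>
      ENNReal.ofReal (Real.exp (predLLR π θ w v q.1 q.2.1 q.2.2)) :=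
  (Real.measurable_exp.comp (measurable_predLLR hθ)).ennreal_ofReal

lemma lintegral_exp_predLLR_law (hθ : Measurable θ) (p : PredictiveDensity n) (ω : Ω)
    (x : Fin n → ℝ) :
    ∫⁻ y, ENNReal.ofReal (Real.exp (predLLR π θ w v ω x y)) ∂(p.law x) =
      ∫⁻ y, ENNReal.ofReal (p.dens x y) * ENNReal.ofReal (Real.exp (predLLR π θ w v ω x y)) := by
  have h : Measurable fun y => ENNReal.ofReal (Real.exp (predLLR π θ w v ω x y)) := by
    have h1 := (measurable_exp_predLLR (π := π) (w := w) (v := v) hθ).comp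
      (show Measurable fun y : Fin n → ℝ => ((ω, x, y) : Ω × (Fin n → ℝ) × (Fin n → ℝ)) by
        fun_prop)
    exact h1
  rw [PredictiveDensity.law,
    lintegral_withDensity_eq_lintegral_mul _ (measurable_dens_ofReal p x) h]
  rfl

lemma measurable_lintegral_exp_predLLR (hθ : Measurable θ) (p : PredictiveDensity n) :
    Measurable (Function.uncurry fun (ω : Ω) (x : Fin n → ℝ) =>
      ∫⁻ y, ENNReal.ofReal (Real.exp (predLLR π θ w v ω x y)) ∂(p.law x)) := by
  have hprod : Measurable fun q : (Ω × (Fin n → ℝ)) × (Fin n → ℝ) =>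
      ENNReal.ofReal (p.dens q.1.2 q.2) *
        ENNReal.ofReal (Real.exp (predLLR π θ w v q.1.1 q.1.2 q.2)) := by
    have h1 := p.measurable_dens.ennreal_ofReal.comp
      (show Measurable fun q : (Ω × (Fin n → ℝ)) × (Fin n → ℝ) => (q.1.2, q.2) by fun_prop)
    have h2 := (measurable_exp_predLLR (π := π) (w := w) (v := v) hθ).comp
      (show Measurable fun q : (Ω × (Fin n → ℝ)) × (Fin n → ℝ) => (q.1.1, q.1.2, q.2) by
        fun_prop)
    exact h1.mul h2
  simp_rw [lintegral_exp_predLLR_law hθ]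
  exact hprod.lintegral_prod_right'

lemma gaussDens_mul_exp_predLLR (hθ : Measurable θ) (hw : 0 < w) (hv : 0 < v) (ω : Ω)
    (x y : Fin n → ℝ) :
    gaussDens w (x - θ ω) * Real.exp (predLLR π θ w v ω x y) =
      gaussDens (w * v / (w + v)) ((v / (w + v)) • x + (w / (w + v)) • y - θ ω) *
      (mixDens π θ w x /
        mixDens π θ (w * v / (w + v)) ((v / (w + v)) • x + (w / (w + v)) • y)) := by
  have hwv : 0 < w + v := by positivity
  have hu : 0 < w * v / (w + v) := by positivity
  have h1 : Real.exp (predLLR π θ w v ω x y) = gaussDens v (y - θ ω) /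
      gaussDens (w + v) (x - y) /
      mixDens π θ (w * v / (w + v)) ((v / (w + v)) • x + (w / (w + v)) • y) *
      mixDens π θ w x := by
    rw [predLLR, Real.exp_add, Real.exp_sub, Real.exp_sub, Real.exp_log (gaussDens_pos hv _),
      Real.exp_log (gaussDens_pos hwv _), Real.exp_log (mixDens_pos hθ hu _),
      Real.exp_log (mixDens_pos hθ hw _)]
  have h2 := gaussDens_mul_gaussDens hv hw x y (θ ω)
  have h3 := (gaussDens_pos hwv (x - y)).ne'
  calc gaussDens w (x - θ ω) * Real.exp (predLLR π θ w v ω x y)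
      = (gaussDens w (x - θ ω) * gaussDens v (y - θ ω)) / gaussDens (w + v) (x - y) *
        (mixDens π θ w x /
          mixDens π θ (w * v / (w + v)) ((v / (w + v)) • x + (w / (w + v)) • y)) := by
        rw [h1]; ring
    _ = _ := by rw [h2, mul_div_cancel_left₀ _ h3]

/-- The likelihood ratio of any predictive density to the Bayes one has mean one. -/
lemma lintegral_exp_predLLR (hθ : Measurable θ) (hw : 0 < w) (hv : 0 < v)
    (p : PredictiveDensity n) :
    ∫⁻ q, ∫⁻ y, ENNReal.ofReal (Real.exp (predLLR π θ w v q.1 (θ q.1 + √w • q.2) y))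
      ∂(p.law (θ q.1 + √w • q.2)) ∂(π.prod (stdGauss n)) = 1 := by
  have hu : 0 < w * v / (w + v) := by positivity
  rw [lintegral_obs (F := fun ω x =>
    ∫⁻ y, ENNReal.ofReal (Real.exp (predLLR π θ w v ω x y)) ∂(p.law x)) hθ hw
    (measurable_lintegral_exp_predLLR hθ p), ← lintegral_mixDens (π := π) hθ hw]
  refine lintegral_congr fun x => ?_
  set T : (Fin n → ℝ) → Fin n → ℝ := fun y => (v / (w + v)) • x + (w / (w + v)) • y with hT
  have hTm : Measurable T := by fun_prop
  have hd1 := measurable_dens_ofReal p x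
  have hg (ω : Ω) : ENNReal.ofReal (gaussDens w (x - θ ω)) *
        ∫⁻ y, ENNReal.ofReal (Real.exp (predLLR π θ w v ω x y)) ∂(p.law x) =
      ∫⁻ y, ENNReal.ofReal (gaussDens (w * v / (w + v)) (T y - θ ω)) *
        (ENNReal.ofReal (p.dens x y) *
          ENNReal.ofReal (mixDens π θ w x / mixDens π θ (w * v / (w + v)) (T y))) := by
    rw [lintegral_exp_predLLR_law hθ, ← lintegral_const_mul' _ _ ENNReal.ofReal_ne_top]
    refine lintegral_congr fun y => ?_
    rw [mul_left_comm, mul_left_comm (ENNReal.ofReal (gaussDens (w * v / (w + v)) _)),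
      ← ENNReal.ofReal_mul (gaussDens_pos hw _).le, ← ENNReal.ofReal_mul (gaussDens_pos hu _).le,
      gaussDens_mul_exp_predLLR hθ hw hv]
  have hmix : Measurable fun y => ENNReal.ofReal (mixDens π θ w x /
      mixDens π θ (w * v / (w + v)) (T y)) :=
    (measurable_const.div ((measurable_mixDens hθ).comp hTm)).ennreal_ofReal
  have hgm : Measurable (Function.uncurry fun (ω : Ω) (y : Fin n → ℝ) =>
      ENNReal.ofReal (gaussDens (w * v / (w + v)) (T y - θ ω)) * (ENNReal.ofReal (p.dens x y) *
          ENNReal.ofReal (mixDens π θ w x / mixDens π θ (w * v / (w + v)) (T y)))) :=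
    Measurable.mul (((measurable_gaussDens _).comp
      ((hTm.comp measurable_snd).sub (hθ.comp measurable_fst))).ennreal_ofReal)
      ((hd1.comp measurable_snd).mul (hmix.comp measurable_snd))
  simp_rw [hg]
  rw [lintegral_lintegral_swap hgm.aemeasurable]
  calc _ = ∫⁻ y, ENNReal.ofReal (p.dens x y) * ENNReal.ofReal (mixDens π θ w x) := by
        refine lintegral_congr fun y => ?_
        rw [lintegral_mul_const _ (by fun_prop), lintegral_gaussDens_sub hθ hu, mul_left_comm,
          ← ENNReal.ofReal_mul (mixDens_pos hθ hu _).le,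
          mul_div_cancel₀ _ (mixDens_pos hθ hu _).ne']
    _ = ENNReal.ofReal (mixDens π θ w x) := by
        rw [lintegral_mul_const _ hd1, p.lintegral_dens, one_mul]

/-- The Bayes risk is a lower bound for the average Kullback-Leibler divergence of every predictive
density; it is expressed by the entropies of the prior blurred at two noise levels. -/
lemma ofReal_le_lintegral_klDiv {w v : ℝ≥0} (hθ : Measurable θ) (hR : ∀ᵐ ω ∂π, ‖θ ω‖ ≤ R)
    (hw : w ≠ 0) (hv : v ≠ 0) (p : PredictiveDensity n) :
    ENNReal.ofReal (n / 2 * Real.log ((w + v) / v) + meanLog π θ w -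
      meanLog π θ (w * v / (w + v))) ≤
    ∫⁻ ω, ∫⁻ x, klDiv (gaussianVec (θ ω) v) (p.law x) ∂(gaussianVec (θ ω) w) ∂π := by
  have hw' : (0 : ℝ) < w := by exact_mod_cast pos_iff_ne_zero.2 hw
  have hv' : (0 : ℝ) < v := by exact_mod_cast pos_iff_ne_zero.2 hv
  obtain ⟨hi, hI, hint⟩ := integral_predLLR hθ hR hw' hv'
  have hE := lintegral_exp_predLLR (π := π) hθ hw' hv' p
  have hobs : Measurable fun q : Ω × (Fin n → ℝ) => (q.1, θ q.1 + √(w : ℝ) • q.2) := by fun_prop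
  have hEm : Measurable fun q : Ω × (Fin n → ℝ) =>
      ∫⁻ y, ENNReal.ofReal (Real.exp (predLLR π θ w v q.1 (θ q.1 + √(w : ℝ) • q.2) y))
        ∂(p.law (θ q.1 + √(w : ℝ) • q.2)) := by
    have h1 := (measurable_lintegral_exp_predLLR (π := π) (w := w) (v := v) hθ p).comp hobs
    exact h1
  rw [lintegral_prod _ hEm.aemeasurable] at hE
  have hm := (measurable_predLLR (π := π) (w := w) (v := v) hθ)
  have hbound (ω : Ω) (z : Fin n → ℝ) :
      ENNReal.ofReal (∫ z', predLLR π θ w v ω (θ ω + √(w : ℝ) • z) (θ ω + √(v : ℝ) • z')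
        ∂(stdGauss n) + 1) ≤
      klDiv (gaussianVec (θ ω) v) (p.law (θ ω + √(w : ℝ) • z)) +
      ∫⁻ y, ENNReal.ofReal (Real.exp (predLLR π θ w v ω (θ ω + √(w : ℝ) • z) y))
        ∂(p.law (θ ω + √(w : ℝ) • z)) := by
    have hm1 : Measurable fun y => predLLR π θ w v ω (θ ω + √(w : ℝ) • z) y := by
      have h1 := hm.comp (show Measurable fun y : Fin n → ℝ =>
        ((ω, θ ω + √(w : ℝ) • z, y) : Ω × (Fin n → ℝ) × (Fin n → ℝ)) by fun_prop)
      exact h1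
    have hI1 : Integrable (fun y => predLLR π θ w v ω (θ ω + √(w : ℝ) • z) y)
        (gaussianVec (θ ω) v) := by
      rw [gaussianVec_eq_map]
      exact (integrable_map_measure hm1.aestronglyMeasurable (by fun_prop)).2 (hi ω z)
    have h := ofReal_integral_add_one_le_klDiv (ν := p.law (θ ω + √(w : ℝ) • z)) hI1 hm1
    have e : ∫ y, predLLR π θ w v ω (θ ω + √(w : ℝ) • z) y ∂(gaussianVec (θ ω) v) =
        ∫ z', predLLR π θ w v ω (θ ω + √(w : ℝ) • z) (θ ω + √(v : ℝ) • z') ∂(stdGauss n) := by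
      rw [gaussianVec_eq_map, integral_map (by fun_prop) hm1.aestronglyMeasurable]
    rwa [e] at h
  have h1 : ∫⁻ ω, ∫⁻ z, ENNReal.ofReal (∫ z', predLLR π θ w v ω (θ ω + √(w : ℝ) • z)
      (θ ω + √(v : ℝ) • z') ∂(stdGauss n) + 1) ∂(stdGauss n) ∂π ≤
      ∫⁻ ω, ∫⁻ x, klDiv (gaussianVec (θ ω) v) (p.law x) ∂(gaussianVec (θ ω) w) ∂π + 1 := by
    rw [← hE, ← lintegral_add_right _ hEm.lintegral_prod_right']
    refine lintegral_mono fun ω => ?_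
    have h2 := hEm.comp (measurable_prodMk_left (x := ω))
    simp only [Function.comp_def] at h2
    rw [lintegral_gaussianVec _ hw, ← lintegral_add_right _ h2]
    exact lintegral_mono fun z => hbound ω z
  have hmc : AEMeasurable (fun q : Ω × (Fin n → ℝ) => ENNReal.ofReal
      (∫ z', predLLR π θ w v q.1 (θ q.1 + √(w : ℝ) • q.2)
      (θ q.1 + √(v : ℝ) • z') ∂(stdGauss n) + 1)) (π.prod (stdGauss n)) :=
    (hI.1.aemeasurable.add_const 1).ennreal_ofReal
  rw [← lintegral_prod (fun q : Ω × (Fin n → ℝ) => ENNReal.ofReal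
      (∫ z', predLLR π θ w v q.1 (θ q.1 + √(w : ℝ) • q.2)
      (θ q.1 + √(v : ℝ) • z') ∂(stdGauss n) + 1)) hmc] at h1
  have h2 := (ofReal_integral_le_lintegral_ofReal (hI.add (integrable_const 1))).trans h1
  rw [integral_add' hI (integrable_const 1), hint] at h2
  simp only [integral_const, probReal_univ, one_smul] at h2
  rcases le_or_gt (n / 2 * Real.log ((w + v) / v) + meanLog π θ w -
      meanLog π θ (w * v / (w + v))) 0 with h0 | h0
  · rw [ENNReal.ofReal_of_nonpos h0]
    exact zero_le
  · rw [ENNReal.ofReal_add h0.le zero_le_one, ENNReal.ofReal_one] at h2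
    exact (ENNReal.add_le_add_iff_right ENNReal.one_ne_top).1 h2

end mixture

/-! ### The van Trees inequality -/

/-- A compactly supported probability density `ρ` on `ℝⁿ`, with score `L = ∇ log ρ`, whose Fisher
information matrix has all its diagonal entries at most one. The differentiability of `ρ` along the
coordinate axes is stated with the derivative `ρ L`, which avoids the logarithm where `ρ`
vanishes. -/
structure IsUnitFisherDensity {n : ℕ} (ρ : (Fin n → ℝ) → ℝ)
    (L : Fin n → (Fin n → ℝ) → ℝ) : Prop where
  nonneg : ∀ φ, 0 ≤ ρ φ
  continuous : Continuous ρ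
  hasCompactSupport : HasCompactSupport ρ
  integral_eq_one : ∫ φ, ρ φ = 1
  measurable_score : ∀ i, Measurable (L i)
  hasLineDerivAt : ∀ i φ, HasLineDerivAt ℝ ρ (ρ φ * L i φ) φ (Pi.single i 1)
  continuous_mul_score : ∀ i, Continuous fun φ => ρ φ * L i φ
  integrable_mul_sq_score : ∀ i, Integrable fun φ => ρ φ * L i φ ^ 2
  integral_mul_sq_score_le : ∀ i, ∫ φ, ρ φ * L i φ ^ 2 ≤ 1

/-- The probability measure with density `ρ`. -/
noncomputable def densMeasure {n : ℕ} (ρ : (Fin n → ℝ) → ℝ) : Measure (Fin n → ℝ) :=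
  volume.withDensity fun φ => ENNReal.ofReal (ρ φ)

/-- The integral of a line derivative of a compactly supported function vanishes. -/
lemma integral_eq_zero_of_hasLineDerivAt {n : ℕ} {f f' : (Fin n → ℝ) → ℝ} {e : Fin n → ℝ}
    (hf : Continuous f) (hfs : HasCompactSupport f) (hf' : Continuous f')
    (hfs' : HasCompactSupport f') (h : ∀ φ, HasLineDerivAt ℝ f (f' φ) φ e) : ∫ φ, f' φ = 0 := by
  have h1 := integral_bilinear_hasLineDerivAt_right_eq_neg_left_of_integrable
    (μ := (volume : Measure (Fin n → ℝ))) (f := fun _ => (1 : ℝ)) (f' := fun _ => 0) (g := f)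
    (g' := f') (v := e) (B := ContinuousLinearMap.mul ℝ ℝ) (by simp)
    (by simpa using hf'.integrable_of_hasCompactSupport hfs')
    (by simpa using hf.integrable_of_hasCompactSupport hfs)
    (fun x _ => by simpa [HasLineDerivAt] using hasDerivAt_const (0 : ℝ) (1 : ℝ))
    (fun x _ => h x)
  simpa using h1

lemma normSq_sub_smul_single {n : ℕ} (y : Fin n → ℝ) (i : Fin n) (r : ℝ) :
    normSq (y - r • Pi.single i 1) = normSq y - 2 * r * y i + r ^ 2 := by
  have h (j : Fin n) : (y - r • (Pi.single i 1 : Fin n → ℝ)) j ^ 2 =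
      y j ^ 2 + if j = i then - 2 * r * y i + r ^ 2 else 0 := by
    by_cases hj : j = i
    · subst hj; simp; ring
    · simp [hj]
  simp only [normSq, h, Finset.sum_add_distrib, Finset.sum_ite_eq', Finset.mem_univ, if_true]
  ring

lemma hasLineDerivAt_gaussDens {n : ℕ} (v : ℝ) (x s φ : Fin n → ℝ) (i : Fin n) :
    HasLineDerivAt ℝ (fun φ => gaussDens v (x - s * φ))
      (gaussDens v (x - s * φ) * (s i * (x i - s i * φ i) / v)) φ (Pi.single i 1) := by
  have e (t : ℝ) : x - s * (φ + t • Pi.single i 1) = (x - s * φ) - (s i * t) • Pi.single i 1 := by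
    ext j
    by_cases hj : j = i
    · subst hj; simp; ring
    · simp [hj]
  unfold HasLineDerivAt
  simp only [e, gaussDens, normSq_sub_smul_single]
  set N := normSq (x - s * φ)
  have h1 : HasDerivAt (fun t : ℝ => -(N - 2 * (s i * t) * (x - s * φ) i + (s i * t) ^ 2) / (2 * v))
      (s i * (x i - s i * φ i) / v) 0 := by
    have h2 : HasDerivAt (fun t : ℝ => s i * t) (s i) 0 := by
      simpa using (hasDerivAt_id (0 : ℝ)).const_mul (s i)
    have h3 := ((((h2.const_mul 2).mul_const ((x - s * φ) i)).const_sub N).add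
      (h2.pow 2)).neg.div_const (2 * v)
    convert! h3 using 1
    simp
    field_simp
  have h4 := (h1.exp).const_mul ((√(2 * Real.pi * v))⁻¹ ^ n)
  convert! h4 using 1
  simp
  ring

namespace IsUnitFisherDensity

variable {n : ℕ} {ρ : (Fin n → ℝ) → ℝ} {L : Fin n → (Fin n → ℝ) → ℝ}

lemma integrable (h : IsUnitFisherDensity ρ L) : Integrable ρ :=
  h.continuous.integrable_of_hasCompactSupport h.hasCompactSupport

lemma isProbabilityMeasure (h : IsUnitFisherDensity ρ L) :
    IsProbabilityMeasure (densMeasure ρ) := by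
  refine ⟨?_⟩
  rw [densMeasure, withDensity_apply _ MeasurableSet.univ, Measure.restrict_univ,
    ← ofReal_integral_eq_lintegral_ofReal h.integrable (ae_of_all _ h.nonneg), h.integral_eq_one]
  simp

lemma integral_densMeasure (h : IsUnitFisherDensity ρ L) (F : (Fin n → ℝ) → ℝ) :
    ∫ φ, F φ ∂(densMeasure ρ) = ∫ φ, ρ φ * F φ := by
  rw [densMeasure, integral_withDensity_eq_integral_toReal_smul
    h.continuous.measurable.ennreal_ofReal (by simp)]
  simp [ENNReal.toReal_ofReal (h.nonneg _)]

lemma integrable_densMeasure_iff (h : IsUnitFisherDensity ρ L) (F : (Fin n → ℝ) → ℝ) :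
    Integrable F (densMeasure ρ) ↔ Integrable fun φ => ρ φ * F φ := by
  rw [densMeasure, integrable_withDensity_iff_integrable_smul'
    h.continuous.measurable.ennreal_ofReal (by simp)]
  simp [ENNReal.toReal_ofReal (h.nonneg _)]

lemma ae_ne_zero (h : IsUnitFisherDensity ρ L) : ∀ᵐ φ ∂(densMeasure ρ), ρ φ ≠ 0 := by
  rw [densMeasure, ae_withDensity_iff h.continuous.measurable.ennreal_ofReal]
  refine ae_of_all _ fun φ hφ h0 => hφ ?_
  simp [h0]

lemma exists_ae_norm_le (h : IsUnitFisherDensity ρ L) (s : Fin n → ℝ) :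
    ∃ R, ∀ᵐ φ ∂(densMeasure ρ), ‖s * φ‖ ≤ R := by
  obtain ⟨R, hR⟩ := h.hasCompactSupport.isCompact.exists_bound_of_continuousOn
    (f := fun φ => s * φ) (by fun_prop)
  refine ⟨R, ?_⟩
  filter_upwards [h.ae_ne_zero] with φ hφ
  exact hR φ (subset_tsupport _ hφ)

/-- The integration by parts behind the van Trees inequality, at a fixed observation `x`. -/
lemma integral_parts (h : IsUnitFisherDensity ρ L) {v : ℝ} (s x : Fin n → ℝ) (i : Fin n) (d : ℝ) :
    ∫ φ, gaussDens v (x - s * φ) * ((s i * φ i - d) * (L i φ + s i * (x i - s i * φ i) / v) + s i)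
      ∂(densMeasure ρ) = 0 := by
  rw [h.integral_densMeasure]
  have hc := h.continuous
  have hcL := h.continuous_mul_score i
  have e (φ : Fin n → ℝ) : ρ φ * (gaussDens v (x - s * φ) *
      ((s i * φ i - d) * (L i φ + s i * (x i - s i * φ i) / v) + s i)) =
      s i * (ρ φ * gaussDens v (x - s * φ)) + (s i * φ i - d) *
        ((ρ φ * L i φ) * gaussDens v (x - s * φ) +
          ρ φ * (gaussDens v (x - s * φ) * (s i * (x i - s i * φ i) / v))) := by ring
  have hsupp {g : (Fin n → ℝ) → ℝ} (hg : ∀ φ, ρ φ = 0 → g φ = 0) : HasCompactSupport g :=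
    h.hasCompactSupport.mono fun φ hφ h0 => hφ (hg φ h0)
  refine integral_eq_zero_of_hasLineDerivAt (e := Pi.single i 1)
    (f := fun φ => (s i * φ i - d) * (ρ φ * gaussDens v (x - s * φ)))
    (by fun_prop) (hsupp fun φ h0 => by simp [h0]) ?_ (hsupp fun φ h0 => by simp [h0])
    fun φ => ?_
  · simp_rw [e]
    fun_prop
  · rw [e]
    have h1 : HasLineDerivAt ℝ (fun φ : Fin n → ℝ => s i * φ i - d) (s i) φ (Pi.single i 1) := by
      unfold HasLineDerivAt
      have : HasDerivAt (fun t : ℝ => s i * (φ i + t) - d) (s i) 0 := by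
        simpa using (((hasDerivAt_id (0 : ℝ)).const_add (φ i)).const_mul (s i)).sub_const d
      simpa using this
    have h2 := h.hasLineDerivAt i φ
    have h3 := hasLineDerivAt_gaussDens v x s φ i
    unfold HasLineDerivAt at *
    have h4 := HasDerivAt.mul h1 (HasDerivAt.mul h2 h3)
    simpa [Pi.mul_def] using h4

/-- The van Trees inequality, for one coordinate. -/
lemma le_integral_sq_sub (h : IsUnitFisherDensity ρ L) {v : ℝ} (hv : 0 < v) (s : Fin n → ℝ)
    (i : Fin n) {d : (Fin n → ℝ) → ℝ} (hd : Measurable d) {R : ℝ} (hdR : ∀ x, |d x| ≤ R)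
    (hR : ∀ᵐ φ ∂(densMeasure ρ), ‖s * φ‖ ≤ R) :
    Integrable (fun p : (Fin n → ℝ) × (Fin n → ℝ) =>
      (s i * p.1 i - d (s * p.1 + √v • p.2)) ^ 2) ((densMeasure ρ).prod (stdGauss n)) ∧
    v * s i ^ 2 / (v + s i ^ 2) ≤
      ∫ p, (s i * p.1 i - d (s * p.1 + √v • p.2)) ^ 2 ∂((densMeasure ρ).prod (stdGauss n)) := by
  have hP := h.isProbabilityMeasure
  have hLm := h.measurable_score i
  set π := densMeasure ρ with hπ
  set e : (Fin n → ℝ) × (Fin n → ℝ) → ℝ := fun p => s i * p.1 i - d (s * p.1 + √v • p.2) with he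
  have hem : Measurable e := by fun_prop
  have hsv : √v ^ 2 = v := Real.sq_sqrt hv.le
  have hsv0 : √v ≠ 0 := by positivity
  have heI : Integrable (fun p => e p ^ 2) (π.prod (stdGauss n)) := by
    refine (integrable_const ((2 * R) ^ 2)).mono' (by fun_prop) ?_
    filter_upwards [Measure.quasiMeasurePreserving_fst.ae hR] with p hp
    rw [norm_pow, Real.norm_eq_abs]
    refine pow_le_pow_left₀ (abs_nonneg _) ?_ 2
    have h1 := norm_le_pi_norm (s * p.1) i
    have h2 := hdR (s * p.1 + √v • p.2)
    have h3 := abs_sub (s i * p.1 i) (d (s * p.1 + √v • p.2))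
    rw [Real.norm_eq_abs, Pi.mul_apply] at h1
    simp only [he]
    linarith
  -- the score of the joint density of the parameter and the observation
  set S : (Fin n → ℝ) × (Fin n → ℝ) → ℝ := fun p => L i p.1 + s i / √v * p.2 i with hS
  have hSm : Measurable S := by fun_prop
  have hL2 : Integrable (fun φ => L i φ ^ 2) π :=
    (h.integrable_densMeasure_iff _).2 (h.integrable_mul_sq_score i)
  have hL1 : Integrable (fun φ => L i φ) π := by
    refine ((integrable_const (1 : ℝ)).add hL2).mono' (by fun_prop) (ae_of_all _ fun φ => ?_)
    rw [Real.norm_eq_abs, Pi.add_apply]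
    rcases abs_cases (L i φ) with hc | hc <;> nlinarith [sq_nonneg (|L i φ| - 1), sq_abs (L i φ)]
  have hz1 := integrable_eval_stdGauss i
  have hz2 : Integrable (fun z : Fin n → ℝ => z i ^ 2) (stdGauss n) := by
    simpa [sq] using integrable_mul_eval_stdGauss i i
  have i1 : Integrable (fun p : (Fin n → ℝ) × (Fin n → ℝ) => L i p.1 ^ 2) (π.prod (stdGauss n)) :=
    hL2.comp_fst _
  have i2 : Integrable (fun p : (Fin n → ℝ) × (Fin n → ℝ) => 2 * (s i / √v) * (L i p.1 * p.2 i))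
      (π.prod (stdGauss n)) := (hL1.mul_prod hz1).const_mul _
  have i3 : Integrable (fun p : (Fin n → ℝ) × (Fin n → ℝ) => s i ^ 2 / v * p.2 i ^ 2)
      (π.prod (stdGauss n)) := (hz2.comp_snd π).const_mul _
  have hSe (p : (Fin n → ℝ) × (Fin n → ℝ)) : S p ^ 2 =
      L i p.1 ^ 2 + 2 * (s i / √v) * (L i p.1 * p.2 i) + s i ^ 2 / v * p.2 i ^ 2 := by
    have : s i ^ 2 / v = (s i / √v) ^ 2 := by rw [div_pow, hsv]
    rw [this, hS]; ring
  have hSI : Integrable (fun p => S p ^ 2) (π.prod (stdGauss n)) := by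
    simp_rw [hSe]
    exact (i1.add i2).add i3
  have hS2 : ∫ p, S p ^ 2 ∂(π.prod (stdGauss n)) ≤ 1 + s i ^ 2 / v := by
    have e1 := integral_add' (i1.add i2) i3
    rw [integral_add' i1 i2] at e1
    have e2 : ∫ p, S p ^ 2 ∂(π.prod (stdGauss n)) = _ := (integral_congr_ae
      (ae_of_all _ hSe)).trans e1
    have e3 : ∫ p : (Fin n → ℝ) × (Fin n → ℝ), L i p.1 ^ 2 ∂(π.prod (stdGauss n)) =
        ∫ φ, ρ φ * L i φ ^ 2 := by
      rw [integral_fun_fst (fun φ : Fin n → ℝ => L i φ ^ 2), h.integral_densMeasure]; simp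
    have e4 : ∫ p : (Fin n → ℝ) × (Fin n → ℝ), 2 * (s i / √v) * (L i p.1 * p.2 i)
        ∂(π.prod (stdGauss n)) = 0 := by
      rw [integral_const_mul, integral_prod_mul (fun φ => L i φ) (fun z : Fin n → ℝ => z i),
        integral_eval_stdGauss]
      simp
    have e5 : ∫ p : (Fin n → ℝ) × (Fin n → ℝ), s i ^ 2 / v * p.2 i ^ 2 ∂(π.prod (stdGauss n)) =
        s i ^ 2 / v := by
      rw [integral_const_mul, integral_fun_snd (fun z : Fin n → ℝ => z i ^ 2),
        integral_sq_eval_stdGauss]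
      simp
    rw [e2, e3, e4, e5]
    have := h.integral_mul_sq_score_le i
    linarith
  have heS : Integrable (fun p => e p * S p) (π.prod (stdGauss n)) := by
    refine (heI.add hSI).mono' (by fun_prop) (ae_of_all _ fun p => ?_)
    rw [Real.norm_eq_abs, abs_mul, Pi.add_apply]
    nlinarith [sq_nonneg (|e p| - |S p|), sq_abs (e p), sq_abs (S p), sq_nonneg (e p),
      sq_nonneg (S p)]
  have hB : ∫ p, e p * S p ∂(π.prod (stdGauss n)) = -s i := by
    have hθ : Measurable fun φ : Fin n → ℝ => s * φ := by fun_prop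
    have hF : Measurable (Function.uncurry fun (φ x : Fin n → ℝ) =>
        (s i * φ i - d x) * (L i φ + s i * (x i - s i * φ i) / v) + s i) := by
      unfold Function.uncurry; fun_prop
    have hrel (p : (Fin n → ℝ) × (Fin n → ℝ)) : (s i * p.1 i - d (s * p.1 + √v • p.2)) *
        (L i p.1 + s i * ((s * p.1 + √v • p.2) i - s i * p.1 i) / v) + s i =
        e p * S p + s i := by
      have : s i * ((s * p.1 + √v • p.2) i - s i * p.1 i) / v = s i / √v * p.2 i := by
        simp only [Pi.add_apply, Pi.mul_apply, Pi.smul_apply, smul_eq_mul]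
        nth_rewrite 2 [← hsv]
        field_simp
        ring
      rw [this]
    have h1 := integral_obs (π := π) (F := fun (φ x : Fin n → ℝ) =>
        (s i * φ i - d x) * (L i φ + s i * (x i - s i * φ i) / v) + s i) hθ hv hF (by
      simp_rw [hrel]
      exact heS.add (integrable_const _))
    simp_rw [hrel] at h1
    rw [integral_add heS (integrable_const _)] at h1
    simp_rw [hπ, h.integral_parts s _ i] at h1
    simp at h1
    linarith
  refine ⟨heI, ?_⟩
  -- `c` maximizes the lower bound `2 c sᵢ - c² (1 + sᵢ² / v)` for the squared error that follows
  -- from `E (e + c S)² ≥ 0`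
  set c := s i * v / (v + s i ^ 2) with hc
  have hpos : 0 < v + s i ^ 2 := by positivity
  have h0 : 0 ≤ ∫ p, (e p ^ 2 + 2 * c * (e p * S p) + c ^ 2 * S p ^ 2) ∂(π.prod (stdGauss n)) :=
    integral_nonneg fun p => by
      have : e p ^ 2 + 2 * c * (e p * S p) + c ^ 2 * S p ^ 2 = (e p + c * S p) ^ 2 := by ring
      simp only [this, Pi.zero_apply]
      positivity
  have e1 := integral_add' (heI.add (heS.const_mul (2 * c))) (hSI.const_mul (c ^ 2))
  rw [integral_add' heI (heS.const_mul (2 * c)), integral_const_mul, integral_const_mul, hB] at e1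
  have e2 := h0.trans_eq e1
  have e3 : c ^ 2 * ∫ p, S p ^ 2 ∂(π.prod (stdGauss n)) ≤ c ^ 2 * (1 + s i ^ 2 / v) :=
    mul_le_mul_of_nonneg_left hS2 (sq_nonneg c)
  have e4 : 2 * c * s i - c ^ 2 * (1 + s i ^ 2 / v) = v * s i ^ 2 / (v + s i ^ 2) := by
    rw [hc]
    field_simp
    ring
  linarith

/-- Under a prior with unit Fisher information, scaled by `s`, estimation is at least as hard as
under the Gaussian prior with variances `sᵢ²`. -/
lemma le_bayesMSE (h : IsUnitFisherDensity ρ L) {v : ℝ} (hv : 0 < v) (s : Fin n → ℝ) :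
    ∑ i, v * s i ^ 2 / (v + s i ^ 2) ≤ bayesMSE (densMeasure ρ) (fun φ => s * φ) v := by
  have hP := h.isProbabilityMeasure
  obtain ⟨R, hR⟩ := h.exists_ae_norm_le s
  have hθ : Measurable fun φ : Fin n → ℝ => s * φ := by fun_prop
  have hi (i : Fin n) := h.le_integral_sq_sub hv s i (measurable_postMean hθ hv i)
    (fun x => abs_postMean_le hθ hR hv x i) hR
  unfold bayesMSE normSq
  simp only [Pi.sub_apply, Pi.mul_apply]
  rw [integral_finsetSum _ fun i _ => (hi i).1]
  exact Finset.sum_le_sum fun i _ => (hi i).2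

end IsUnitFisherDensity

/-! ### A prior with unit Fisher information supported in an ellipsoid -/

/-- The quadratic form `∑ᵢ wᵢ φᵢ²`. -/
def wSq {n : ℕ} (w φ : Fin n → ℝ) : ℝ := ∑ i, w i * φ i ^ 2

@[fun_prop]
lemma continuous_wSq {n : ℕ} (w : Fin n → ℝ) : Continuous (wSq w) := by
  unfold wSq; fun_prop

lemma wSq_add_smul_single {n : ℕ} (w φ : Fin n → ℝ) (i : Fin n) (t : ℝ) :
    wSq w (φ + t • Pi.single i 1) = wSq w φ + w i * (2 * t * φ i + t ^ 2) := by
  have h (j : Fin n) : w j * (φ + t • (Pi.single i 1 : Fin n → ℝ)) j ^ 2 =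
      w j * φ j ^ 2 + if j = i then w i * (2 * t * φ i + t ^ 2) else 0 := by
    by_cases hj : j = i
    · subst hj; simp; ring
    · simp [hj]
  simp only [wSq, h, Finset.sum_add_distrib, Finset.sum_ite_eq', Finset.mem_univ, if_true]

lemma hasDerivAt_wSq {n : ℕ} (w φ : Fin n → ℝ) (i : Fin n) :
    HasDerivAt (fun t : ℝ => wSq w (φ + t • Pi.single i 1)) (2 * w i * φ i) 0 := by
  simp_rw [wSq_add_smul_single]
  have h1 : HasDerivAt (fun t : ℝ => 2 * t * φ i + t ^ 2) (2 * φ i) 0 := by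
    have h2 := (((hasDerivAt_id (0 : ℝ)).const_mul 2).mul_const (φ i)).add
      ((hasDerivAt_id (0 : ℝ)).pow 2)
    simpa [Pi.add_def] using h2
  have h3 := (h1.const_mul (w i)).const_add (wSq w φ)
  convert! h3 using 1
  ring

lemma hasDerivAt_max_zero_sq (r : ℝ) :
    HasDerivAt (fun r : ℝ => max r 0 ^ 2) (2 * max r 0) r := by
  rcases lt_trichotomy r 0 with h | rfl | h
  · rw [max_eq_right h.le, mul_zero]
    refine (hasDerivAt_const r (0 : ℝ)).congr_of_eventuallyEq ?_
    filter_upwards [gt_mem_nhds h] with x hx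
    simp [max_eq_right hx.le]
  · rw [hasDerivAt_iff_isLittleO_nhds_zero]
    simp only [zero_add, max_self, mul_zero, smul_zero, sub_zero]
    refine Asymptotics.IsBigO.trans_isLittleO (g := fun h : ℝ => h ^ 2) ?_ ?_
    · refine Asymptotics.IsBigO.of_bound 1 (Eventually.of_forall fun x => ?_)
      rcases le_total x 0 with hx | hx
      · simp [max_eq_right hx]; positivity
      · simp [max_eq_left hx]
    · simpa using Asymptotics.isLittleO_pow_id (𝕜 := ℝ) one_lt_two
  · rw [max_eq_left h.le]
    have h1 : HasDerivAt (fun x : ℝ => x ^ 2) (2 * r) r := by simpa using hasDerivAt_pow 2 r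
    refine h1.congr_of_eventuallyEq ?_
    filter_upwards [lt_mem_nhds h] with x hx
    simp [max_eq_left hx.le]

/-- The fourth moment of the standard Gaussian distribution. -/
noncomputable def gaussFourth : ℝ := ∫ x, x ^ 4 ∂(gaussianReal 0 1)

lemma gaussFourth_nonneg : 0 ≤ gaussFourth := integral_nonneg fun x => by positivity

lemma integral_pow_four_gaussianReal (v : ℝ≥0) :
    ∫ x, x ^ 4 ∂(gaussianReal 0 v) = v ^ 2 * gaussFourth := by
  have h := gaussianReal_map_const_mul (μ := 0) (v := 1) (√v)
  have h2 : gaussianReal 0 v = (gaussianReal 0 1).map (√(v : ℝ) * ·) := by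
    rw [h]
    congr 1
    · simp
    · ext; simp
  rw [h2, integral_map (by fun_prop) (by fun_prop), gaussFourth, ← integral_const_mul]
  refine integral_congr_ae (ae_of_all _ fun x => ?_)
  have : √(v : ℝ) ^ 4 = (v : ℝ) ^ 2 := by
    rw [show (4 : ℕ) = 2 * 2 from rfl, pow_mul, Real.sq_sqrt v.coe_nonneg]
  simp only [mul_pow, this]

section prior

variable {n : ℕ} (b : Fin n → ℝ) (C : ℝ) (τ : Fin n → ℝ≥0)

/-- The distance to the boundary of the ellipsoid, `(C - ∑ᵢ bᵢ φᵢ²)₊`. -/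
def cutoff (φ : Fin n → ℝ) : ℝ := max (C - wSq b φ) 0

@[fun_prop]
lemma continuous_cutoff : Continuous (cutoff b C) := by
  unfold cutoff; fun_prop

lemma wSq_lt_of_cutoff_ne_zero {φ : Fin n → ℝ} (h : cutoff b C φ ≠ 0) : wSq b φ < C := by
  by_contra! h1
  exact h (max_eq_right (by linarith))

lemma hasDerivAt_cutoff_sq (φ : Fin n → ℝ) (i : Fin n) :
    HasDerivAt (fun t : ℝ => cutoff b C (φ + t • Pi.single i 1) ^ 2)
      (-(4 * b i * φ i * cutoff b C φ)) 0 := by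
  have h1 := (hasDerivAt_wSq b φ i).const_sub C
  have h2 := hasDerivAt_max_zero_sq (C - wSq b (φ + (0 : ℝ) • Pi.single i 1))
  have h3 := h2.comp (0 : ℝ) h1
  simp only [zero_smul, add_zero] at h3
  convert! h3 using 1
  unfold cutoff
  ring

/-- The density of the centred Gaussian vector with independent coordinates of variances `τᵢ`. -/
noncomputable def diagGauss (φ : Fin n → ℝ) : ℝ := ∏ i, gaussianPDFReal 0 (τ i) (φ i)

lemma diagGauss_eq (φ : Fin n → ℝ) : diagGauss τ φ =
    (∏ i, (√(2 * Real.pi * τ i))⁻¹) * Real.exp (-wSq (fun i => (2 * (τ i : ℝ))⁻¹) φ) := by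
  simp only [diagGauss, gaussianPDFReal, Finset.prod_mul_distrib, ← Real.exp_sum, wSq, sub_zero]
  rw [← Finset.sum_neg_distrib]
  congr 3
  ext i
  rw [neg_div, div_eq_inv_mul]

@[fun_prop]
lemma continuous_diagGauss : Continuous (diagGauss τ) := by
  rw [funext (diagGauss_eq τ)]; fun_prop

lemma diagGauss_nonneg (φ : Fin n → ℝ) : 0 ≤ diagGauss τ φ :=
  Finset.prod_nonneg fun _ _ => gaussianPDFReal_nonneg _ _ _

lemma hasDerivAt_diagGauss (φ : Fin n → ℝ) (i : Fin n) :
    HasDerivAt (fun t : ℝ => diagGauss τ (φ + t • Pi.single i 1))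
      (-(φ i / τ i * diagGauss τ φ)) 0 := by
  simp_rw [diagGauss_eq]
  have h1 := ((hasDerivAt_wSq (fun i => (2 * (τ i : ℝ))⁻¹) φ i).neg.exp).const_mul
    (∏ i, (√(2 * Real.pi * τ i))⁻¹)
  convert! h1 using 1
  simp
  ring

lemma pi_gaussianReal_eq (hτ : ∀ i, τ i ≠ 0) : Measure.pi (fun i => gaussianReal 0 (τ i)) =
    volume.withDensity fun φ => ENNReal.ofReal (diagGauss τ φ) :=
  pi_gaussianReal_eq_withDensity (fun _ => 0) τ hτ

lemma integral_pi_gaussianReal (hτ : ∀ i, τ i ≠ 0) (F : (Fin n → ℝ) → ℝ) :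
    ∫ φ, F φ ∂(Measure.pi fun i => gaussianReal 0 (τ i)) = ∫ φ, diagGauss τ φ * F φ := by
  rw [pi_gaussianReal_eq τ hτ, integral_withDensity_eq_integral_toReal_smul
    (continuous_diagGauss τ).measurable.ennreal_ofReal (by simp)]
  simp [ENNReal.toReal_ofReal (diagGauss_nonneg τ _)]

lemma integrable_pi_gaussianReal_iff (hτ : ∀ i, τ i ≠ 0) (F : (Fin n → ℝ) → ℝ) :
    Integrable F (Measure.pi fun i => gaussianReal 0 (τ i)) ↔
      Integrable fun φ => diagGauss τ φ * F φ := by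
  rw [pi_gaussianReal_eq τ hτ, integrable_withDensity_iff_integrable_smul'
    (continuous_diagGauss τ).measurable.ennreal_ofReal (by simp)]
  simp [ENNReal.toReal_ofReal (diagGauss_nonneg τ _)]

variable {b} in
lemma hasCompactSupport_cutoff (hb : ∀ i, 0 < b i) : HasCompactSupport (cutoff b C) := by
  refine HasCompactSupport.intro
    (isCompact_Icc (a := fun i => -√(C / b i)) (b := fun i => √(C / b i))) fun φ hφ => ?_
  by_contra h
  have hlt := wSq_lt_of_cutoff_ne_zero b C h
  refine hφ ?_
  have hi (i : Fin n) : |φ i| ≤ √(C / b i) := by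
    refine Real.abs_le_sqrt ?_
    rw [le_div_iff₀ (hb i), mul_comm]
    refine le_trans ?_ hlt.le
    exact Finset.single_le_sum (f := fun i => b i * φ i ^ 2)
      (fun j _ => mul_nonneg (hb j).le (sq_nonneg _)) (Finset.mem_univ i)
  exact ⟨fun i => (abs_le.1 (hi i)).1, fun i => (abs_le.1 (hi i)).2⟩

/-- The normalisation of the prior density. -/
noncomputable def priorMass : ℝ :=
  ∫ φ, cutoff b C φ ^ 2 ∂(Measure.pi fun i => gaussianReal 0 (τ i))

/-- The prior density, the Gaussian density with variances `τᵢ` damped by the squared distance to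
the boundary of the ellipsoid. -/
noncomputable def priorDens (φ : Fin n → ℝ) : ℝ :=
  (priorMass b C τ)⁻¹ * (cutoff b C φ ^ 2 * diagGauss τ φ)

/-- The score of the prior density; the division by zero outside of the ellipsoid is harmless, the
density vanishing there. -/
noncomputable def priorScore (i : Fin n) (φ : Fin n → ℝ) : ℝ :=
  -(4 * b i * φ i / cutoff b C φ) - φ i / τ i

lemma cutoff_sq_mul_priorScore (i : Fin n) (φ : Fin n → ℝ) :
    cutoff b C φ ^ 2 * priorScore b C τ i φ =
      -(4 * b i * φ i * cutoff b C φ) - cutoff b C φ ^ 2 * (φ i / τ i) := by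
  unfold priorScore
  rcases eq_or_ne (cutoff b C φ) 0 with h | h
  · simp [h]
  · field_simp

lemma cutoff_sq_mul_priorScore_sq_le (i : Fin n) (φ : Fin n → ℝ) :
    cutoff b C φ ^ 2 * priorScore b C τ i φ ^ 2 ≤ 16 * b i ^ 2 * φ i ^ 2 +
      8 * b i / τ i * (φ i ^ 2 * cutoff b C φ) +
      ((τ i : ℝ)⁻¹) ^ 2 * (cutoff b C φ ^ 2 * φ i ^ 2) := by
  unfold priorScore
  rcases eq_or_ne (cutoff b C φ) 0 with h | h
  · simp only [h]
    have : 0 ≤ 16 * b i ^ 2 * φ i ^ 2 := by positivity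
    simpa using this
  · refine le_of_eq ?_
    rw [div_eq_mul_inv (φ i), div_eq_mul_inv (8 * b i)]
    field_simp
    ring

variable {b C τ}

lemma integrable_cutoff_pow (hb : ∀ i, 0 < b i) (k : ℕ) (hk : k ≠ 0) :
    Integrable (fun φ => cutoff b C φ ^ k) (Measure.pi fun i => gaussianReal 0 (τ i)) := by
  refine Continuous.integrable_of_hasCompactSupport (by fun_prop) ?_
  exact (hasCompactSupport_cutoff C hb).comp_left (g := fun x => x ^ k) (by simp [hk])

lemma integrable_cutoff_pow_mul (hb : ∀ i, 0 < b i) (k : ℕ) (hk : k ≠ 0)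
    (i : Fin n) :
    Integrable (fun φ => φ i ^ 2 * cutoff b C φ ^ k)
      (Measure.pi fun i => gaussianReal 0 (τ i)) := by
  refine Continuous.integrable_of_hasCompactSupport (by fun_prop) ?_
  exact ((hasCompactSupport_cutoff C hb).comp_left (g := fun x => x ^ k) (by simp [hk])).mul_left

/-- The mass of the prior is bounded below through Jensen's inequality. -/
lemma sq_le_priorMass (hb : ∀ i, 0 < b i) {D : ℝ} (hD : 0 ≤ D)
    (hDC : D ≤ C - ∑ i, b i * τ i) :
    D ^ 2 ≤ priorMass b C τ := by
  have hI2 := integrable_cutoff_pow (C := C) (τ := τ) hb 2 two_ne_zero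
  have hI1 : Integrable (cutoff b C) (Measure.pi fun i => gaussianReal 0 (τ i)) := by
    simpa using integrable_cutoff_pow (C := C) (τ := τ) hb 1 one_ne_zero
  have hQi (i : Fin n) : Integrable (fun φ : Fin n → ℝ => b i * φ i ^ 2)
      (Measure.pi fun i => gaussianReal 0 (τ i)) :=
    (integrable_comp_eval (μ := fun i => gaussianReal 0 (τ i)) (i := i) (f := fun x => x ^ 2)
      (integrable_pow_gaussianReal _ 2)).const_mul _
  have hQ : Integrable (wSq b) (Measure.pi fun i => gaussianReal 0 (τ i)) := by
    unfold wSq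
    exact integrable_finsetSum _ fun i _ => hQi i
  have hQe : ∫ φ, wSq b φ ∂(Measure.pi fun i => gaussianReal 0 (τ i)) = ∑ i, b i * τ i := by
    unfold wSq
    rw [integral_finsetSum _ fun i _ => hQi i]
    refine Finset.sum_congr rfl fun i _ => ?_
    rw [integral_const_mul, integral_comp_eval (μ := fun i => gaussianReal 0 (τ i)) (i := i)
      (f := fun x : ℝ => x ^ 2) (by fun_prop), integral_sq_gaussianReal]
  have h1 : D ≤ ∫ φ, cutoff b C φ ∂(Measure.pi fun i => gaussianReal 0 (τ i)) := by
    calc D ≤ ∫ φ, (C - wSq b φ) ∂(Measure.pi fun i => gaussianReal 0 (τ i)) := by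
          rw [integral_sub (integrable_const _) hQ, hQe]
          simpa using hDC
      _ ≤ _ := integral_mono ((integrable_const _).sub hQ) hI1 fun φ => le_max_left _ _
  have h2 : ∫ φ, (2 * D * cutoff b C φ - D ^ 2) ∂(Measure.pi fun i => gaussianReal 0 (τ i)) ≤
      priorMass b C τ :=
    integral_mono ((hI1.const_mul _).sub (integrable_const _)) hI2 fun φ => by
      simp only
      nlinarith [sq_nonneg (cutoff b C φ - D)]
  rw [integral_sub (hI1.const_mul _) (integrable_const _), integral_const_mul] at h2
  simp only [integral_const, probReal_univ, one_smul] at h2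
  nlinarith

/-- Stein's identity for the damped Gaussian density. -/
lemma integral_sq_mul_cutoff_sq (hb : ∀ i, 0 < b i) (hτ : ∀ i, τ i ≠ 0) (i : Fin n) :
    (τ i : ℝ)⁻¹ * ∫ φ, φ i ^ 2 * cutoff b C φ ^ 2 ∂(Measure.pi fun i => gaussianReal 0 (τ i)) =
      priorMass b C τ -
      4 * b i * ∫ φ, φ i ^ 2 * cutoff b C φ ∂(Measure.pi fun i => gaussianReal 0 (τ i)) := by
  have hI2 := integrable_cutoff_pow (C := C) (τ := τ) hb 2 two_ne_zero
  have hJ1 : Integrable (fun φ => φ i ^ 2 * cutoff b C φ)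
      (Measure.pi fun i => gaussianReal 0 (τ i)) := by
    simpa using integrable_cutoff_pow_mul (C := C) (τ := τ) hb 1 one_ne_zero i
  have hJ2 := integrable_cutoff_pow_mul (C := C) (τ := τ) hb 2 two_ne_zero i
  have hsupp {g : (Fin n → ℝ) → ℝ} (hg : ∀ φ, cutoff b C φ = 0 → g φ = 0) :
      HasCompactSupport g :=
    (hasCompactSupport_cutoff C hb).mono fun φ hφ h0 => hφ (hg φ h0)
  have h0 : ∫ φ, (cutoff b C φ ^ 2 - 4 * b i * (φ i ^ 2 * cutoff b C φ) -
      (τ i : ℝ)⁻¹ * (φ i ^ 2 * cutoff b C φ ^ 2))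
        ∂(Measure.pi fun i => gaussianReal 0 (τ i)) = 0 := by
    rw [integral_pi_gaussianReal τ hτ]
    refine integral_eq_zero_of_hasLineDerivAt (e := Pi.single i 1)
      (f := fun φ => φ i * (cutoff b C φ ^ 2 * diagGauss τ φ)) (by fun_prop)
      (hsupp fun φ h => by simp [h]) (by fun_prop) (hsupp fun φ h => by simp [h]) fun φ => ?_
    unfold HasLineDerivAt
    have h1 : HasDerivAt (fun t : ℝ => (φ + t • (Pi.single i 1 : Fin n → ℝ)) i) 1 0 := by
      simpa using (hasDerivAt_id (0 : ℝ)).const_add (φ i)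
    have h2 := h1.fun_mul ((hasDerivAt_cutoff_sq b C φ i).fun_mul (hasDerivAt_diagGauss τ φ i))
    convert! h2 using 1
    simp
    ring
  have e1 := integral_sub' (hI2.sub (hJ1.const_mul (4 * b i))) (hJ2.const_mul ((τ i : ℝ)⁻¹))
  rw [integral_sub' hI2 (hJ1.const_mul (4 * b i)), integral_const_mul, integral_const_mul] at e1
  have h0 := e1.symm.trans h0
  rw [priorMass]
  linarith

/-- The Fisher information of the damped Gaussian density. -/
lemma integral_cutoff_sq_mul_score_sq_le (hb : ∀ i, 0 < b i) (hτ : ∀ i, τ i ≠ 0)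
    {D : ℝ} (hD : 0 < D) (hDC : D ≤ C - ∑ i, b i * τ i)
    (i : Fin n) :
    Integrable (fun φ => cutoff b C φ ^ 2 * priorScore b C τ i φ ^ 2)
      (Measure.pi fun i => gaussianReal 0 (τ i)) ∧
    ∫ φ, cutoff b C φ ^ 2 * priorScore b C τ i φ ^ 2 ∂(Measure.pi fun i => gaussianReal 0 (τ i)) ≤
      priorMass b C τ * ((τ i : ℝ)⁻¹ + 2 * (gaussFourth + 1) * (b i / D) +
        16 * τ i * (b i / D) ^ 2) := by
  have hZ := sq_le_priorMass hb hD.le hDC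
  have hJ1 : Integrable (fun φ => φ i ^ 2 * cutoff b C φ)
      (Measure.pi fun i => gaussianReal 0 (τ i)) := by
    simpa using integrable_cutoff_pow_mul (C := C) (τ := τ) hb 1 one_ne_zero i
  have hI2 := integrable_cutoff_pow (C := C) (τ := τ) hb 2 two_ne_zero
  have hJ2 := integrable_cutoff_pow_mul (C := C) (τ := τ) hb 2 two_ne_zero i
  have hJ2' : Integrable (fun φ => cutoff b C φ ^ 2 * φ i ^ 2)
      (Measure.pi fun i => gaussianReal 0 (τ i)) := by simpa only [mul_comm] using hJ2
  have hM2 : Integrable (fun φ : Fin n → ℝ => φ i ^ 2)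
      (Measure.pi fun i => gaussianReal 0 (τ i)) :=
    integrable_comp_eval (μ := fun i => gaussianReal 0 (τ i)) (i := i) (f := fun x => x ^ 2)
      (integrable_pow_gaussianReal _ 2)
  have hM4 : Integrable (fun φ : Fin n → ℝ => φ i ^ 4)
      (Measure.pi fun i => gaussianReal 0 (τ i)) :=
    integrable_comp_eval (μ := fun i => gaussianReal 0 (τ i)) (i := i) (f := fun x => x ^ 4)
      (integrable_pow_gaussianReal _ 4)
  have hE2 : ∫ φ : Fin n → ℝ, φ i ^ 2 ∂(Measure.pi fun i => gaussianReal 0 (τ i)) = τ i := by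
    rw [integral_comp_eval (μ := fun i => gaussianReal 0 (τ i)) (i := i)
      (f := fun x : ℝ => x ^ 2) (by fun_prop), integral_sq_gaussianReal]
  have hE4 : ∫ φ : Fin n → ℝ, φ i ^ 4 ∂(Measure.pi fun i => gaussianReal 0 (τ i)) =
      τ i ^ 2 * gaussFourth := by
    rw [integral_comp_eval (μ := fun i => gaussianReal 0 (τ i)) (i := i)
      (f := fun x : ℝ => x ^ 4) (by fun_prop), integral_pow_four_gaussianReal]
  have hτ0 : (0 : ℝ) < τ i := by exact_mod_cast pos_iff_ne_zero.2 (hτ i)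
  have hub : Integrable (fun φ => 16 * b i ^ 2 * φ i ^ 2 +
      8 * b i / τ i * (φ i ^ 2 * cutoff b C φ) +
      ((τ i : ℝ)⁻¹) ^ 2 * (cutoff b C φ ^ 2 * φ i ^ 2))
      (Measure.pi fun i => gaussianReal 0 (τ i)) :=
    ((hM2.const_mul _).add (hJ1.const_mul _)).add (hJ2'.const_mul _)
  have hsm : Measurable fun φ => cutoff b C φ ^ 2 * priorScore b C τ i φ ^ 2 := by
    unfold priorScore
    have := (continuous_cutoff b C).measurable
    fun_prop
  have hint : Integrable (fun φ => cutoff b C φ ^ 2 * priorScore b C τ i φ ^ 2)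
      (Measure.pi fun i => gaussianReal 0 (τ i)) := by
    refine hub.mono' hsm.aestronglyMeasurable (ae_of_all _ fun φ => ?_)
    rw [Real.norm_eq_abs, abs_of_nonneg (by positivity)]
    exact cutoff_sq_mul_priorScore_sq_le b C τ i φ
  refine ⟨hint, (integral_mono hint hub fun φ =>
    cutoff_sq_mul_priorScore_sq_le b C τ i φ).trans ?_⟩
  have e1 := integral_add' ((hM2.const_mul (16 * b i ^ 2)).add (hJ1.const_mul (8 * b i / τ i)))
    (hJ2'.const_mul (((τ i : ℝ)⁻¹) ^ 2))
  rw [integral_add' (hM2.const_mul (16 * b i ^ 2)) (hJ1.const_mul (8 * b i / τ i)),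
    integral_const_mul, integral_const_mul, integral_const_mul, hE2] at e1
  refine (le_of_eq e1).trans ?_
  have hS := integral_sq_mul_cutoff_sq (C := C) hb hτ i
  simp_rw [mul_comm (cutoff b C _ ^ 2)]
  set E2 := ∫ φ, φ i ^ 2 * cutoff b C φ ^ 2 ∂(Measure.pi fun i => gaussianReal 0 (τ i))
  set E1 := ∫ φ, φ i ^ 2 * cutoff b C φ ∂(Measure.pi fun i => gaussianReal 0 (τ i)) with hE1
  set Z := priorMass b C τ with hZdef
  -- the mixed moment is split by the inequality of arithmetic and geometric means
  have hE1le : E1 ≤ 1 / 2 * (D * τ i * gaussFourth + τ i * (Z / D)) := by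
    have h1 : E1 ≤ ∫ φ, (D / (2 * τ i) * φ i ^ 4 + τ i / (2 * D) * cutoff b C φ ^ 2)
        ∂(Measure.pi fun i => gaussianReal 0 (τ i)) :=
      integral_mono hJ1 ((hM4.const_mul _).add (hI2.const_mul _)) fun φ => by
        have h2 : D / (2 * τ i) * φ i ^ 4 + τ i / (2 * D) * cutoff b C φ ^ 2 -
            φ i ^ 2 * cutoff b C φ =
            1 / (2 * D * τ i) * (D * φ i ^ 2 - τ i * cutoff b C φ) ^ 2 := by
          field_simp
          ring
        have h3 : 0 ≤ 1 / (2 * D * τ i) * (D * φ i ^ 2 - τ i * cutoff b C φ) ^ 2 := by positivity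
        simp only
        linarith
    rw [integral_add (hM4.const_mul _) (hI2.const_mul _), integral_const_mul, integral_const_mul,
      hE4] at h1
    refine h1.trans (le_of_eq ?_)
    rw [show ∫ φ, cutoff b C φ ^ 2 ∂(Measure.pi fun i => gaussianReal 0 (τ i)) = Z from rfl]
    field_simp
  have hDZ : D ≤ Z / D := by rw [le_div_iff₀ hD]; nlinarith
  have hbi := hb i
  have h4 : 4 * b i / τ i * E1 ≤ Z * (2 * (gaussFourth + 1) * (b i / D)) := by
    calc 4 * b i / τ i * E1
        ≤ 4 * b i / τ i * (1 / 2 * (D * τ i * gaussFourth + τ i * (Z / D))) :=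
          mul_le_mul_of_nonneg_left hE1le (by positivity)
      _ = 2 * b i * (D * gaussFourth + Z / D) := by field_simp; ring
      _ ≤ 2 * b i * (Z / D * gaussFourth + Z / D) := by
          have := mul_le_mul_of_nonneg_right hDZ gaussFourth_nonneg
          exact mul_le_mul_of_nonneg_left (by linarith) (by positivity)
      _ = _ := by ring
  have h5 : 16 * b i ^ 2 * τ i ≤ Z * (16 * τ i * (b i / D) ^ 2) := by
    have : 16 * b i ^ 2 * τ i = D ^ 2 * (16 * τ i * (b i / D) ^ 2) := by field_simp
    rw [this]
    exact mul_le_mul_of_nonneg_right hZ (by positivity)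
  have h6 : ((τ i : ℝ)⁻¹) ^ 2 * E2 = (τ i : ℝ)⁻¹ * Z - 4 * b i / τ i * E1 := by
    rw [sq, mul_assoc, hS]; ring
  have h7 : 8 * b i / τ i * E1 = 2 * (4 * b i / τ i * E1) := by ring
  rw [h6, h7]
  linarith

/-- If the budget `C` exceeds `∑ bᵢ` by a large multiple of `(∑ bᵢ²)^{1/2}`, then the ellipsoid
`∑ bᵢ φᵢ² ≤ C` carries a probability density with unit Fisher information. -/
lemma exists_isUnitFisherDensity (hn : 0 < n) (hb : ∀ i, 0 < b i)
    (hC : ∑ i, b i + (1 + 16 * (gaussFourth + 1)) * √(∑ i, b i ^ 2) ≤ C) :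
    ∃ ρ L, IsUnitFisherDensity (n := n) ρ L ∧ ∀ φ, ρ φ ≠ 0 → wSq b φ ≤ C := by
  set N := √(∑ i, b i ^ 2) with hN
  have hNsq : N ^ 2 = ∑ i, b i ^ 2 := Real.sq_sqrt (Finset.sum_nonneg fun _ _ => sq_nonneg _)
  have hbN (i : Fin n) : b i ≤ N := by
    refine Real.le_sqrt_of_sq_le ?_
    exact Finset.single_le_sum (f := fun i => b i ^ 2) (fun _ _ => sq_nonneg _)
      (Finset.mem_univ i)
  have hN0 : 0 < N := (hb ⟨0, hn⟩).trans_le (hbN _)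
  have hM := gaussFourth_nonneg
  -- the variances are enlarged in proportion to the share of each coordinate in the budget
  set τ : Fin n → ℝ≥0 := fun i => ⟨1 + b i / N, by have := hb i; positivity⟩ with hτdef
  have hτe (i : Fin n) : (τ i : ℝ) = 1 + b i / N := rfl
  have hτ (i : Fin n) : τ i ≠ 0 := by
    have h1 := hb i
    have : (0 : ℝ) < τ i := by rw [hτe]; positivity
    exact_mod_cast this.ne'
  set D := 16 * (gaussFourth + 1) * N with hD
  have hD0 : 0 < D := by positivity
  have hsum : ∑ i, b i * τ i = ∑ i, b i + N := by
    have : ∀ i, b i * τ i = b i + b i ^ 2 / N := fun i => by rw [hτe]; field_simp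
    simp_rw [this]
    rw [Finset.sum_add_distrib, ← Finset.sum_div, ← hNsq]
    field_simp
  have hDC : D ≤ C - ∑ i, b i * τ i := by rw [hsum, hD]; linarith
  have hZ : 0 < priorMass b C τ := (pow_pos hD0 2).trans_le (sq_le_priorMass hb hD0.le hDC)
  have hI2 := integrable_cutoff_pow (C := C) (τ := τ) hb 2 two_ne_zero
  refine ⟨priorDens b C τ, priorScore b C τ, ⟨fun φ => ?_, ?_, ?_, ?_, fun i => ?_, fun i φ => ?_,
    fun i => ?_, fun i => ?_, fun i => ?_⟩, fun φ hφ => ?_⟩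
  · have := diagGauss_nonneg τ φ
    unfold priorDens; positivity
  · unfold priorDens; fun_prop
  · exact (hasCompactSupport_cutoff C hb).mono fun φ hφ h0 => hφ (by simp [priorDens, h0])
  · unfold priorDens
    rw [integral_const_mul]
    simp_rw [mul_comm (cutoff b C _ ^ 2)]
    rw [← integral_pi_gaussianReal τ hτ]
    exact inv_mul_cancel₀ hZ.ne'
  · unfold priorScore
    have := (continuous_cutoff b C).measurable
    fun_prop
  · unfold HasLineDerivAt priorDens
    have h2 := ((hasDerivAt_cutoff_sq b C φ i).fun_mul (hasDerivAt_diagGauss τ φ i)).const_mul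
      (priorMass b C τ)⁻¹
    convert! h2 using 1
    have := cutoff_sq_mul_priorScore b C τ i φ
    calc (priorMass b C τ)⁻¹ * (cutoff b C φ ^ 2 * diagGauss τ φ) * priorScore b C τ i φ
        = (priorMass b C τ)⁻¹ * ((cutoff b C φ ^ 2 * priorScore b C τ i φ) * diagGauss τ φ) := by
          ring
      _ = _ := by rw [this]; simp only [zero_smul, add_zero]; ring
  · have e (φ : Fin n → ℝ) : priorDens b C τ φ * priorScore b C τ i φ =
        (priorMass b C τ)⁻¹ * ((-(4 * b i * φ i * cutoff b C φ) -
          cutoff b C φ ^ 2 * (φ i / τ i)) * diagGauss τ φ) := by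
      rw [← cutoff_sq_mul_priorScore, priorDens]; ring
    simp_rw [e]
    fun_prop
  · have h1 := (integral_cutoff_sq_mul_score_sq_le (C := C) hb hτ hD0 hDC i).1
    have h2 := ((integrable_pi_gaussianReal_iff τ hτ _).1 h1).const_mul (priorMass b C τ)⁻¹
    refine h2.congr (ae_of_all _ fun φ => ?_)
    simp only [priorDens]; ring
  · have h1 := (integral_cutoff_sq_mul_score_sq_le (C := C) hb hτ hD0 hDC i).2
    rw [integral_pi_gaussianReal τ hτ] at h1
    have e (φ : Fin n → ℝ) : priorDens b C τ φ * priorScore b C τ i φ ^ 2 =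
        (priorMass b C τ)⁻¹ * (diagGauss τ φ *
          (cutoff b C φ ^ 2 * priorScore b C τ i φ ^ 2)) := by
      rw [priorDens]; ring
    simp_rw [e]
    rw [integral_const_mul, inv_mul_le_iff₀ hZ, mul_one]
    refine h1.trans (mul_le_of_le_one_right hZ.le ?_)
    set y := b i / N with hy
    have hy0 : 0 < y := div_pos (hb i) hN0
    have hy1 : y ≤ 1 := (div_le_one hN0).2 (hbN i)
    have e1 : b i / D = y / (16 * (gaussFourth + 1)) := by rw [hD, hy]; field_simp
    have h2 : (τ i : ℝ)⁻¹ ≤ 1 - y / 2 := by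
      rw [hτe, inv_le_iff_one_le_mul₀ (by positivity)]
      nlinarith
    have h3 : 2 * (gaussFourth + 1) * (b i / D) = y / 8 := by rw [e1]; field_simp; ring
    have h4 : b i / D ≤ y / 16 := by
      rw [e1]
      exact div_le_div_of_nonneg_left hy0.le (by norm_num) (by linarith)
    have h5 : (b i / D) ^ 2 ≤ (y / 16) ^ 2 :=
      pow_le_pow_left₀ (div_nonneg (hb i).le hD0.le) h4 2
    have h6 : 16 * (τ i : ℝ) * (b i / D) ^ 2 ≤ 16 * 2 * (y / 16) ^ 2 := by
      rw [hτe]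
      gcongr
      linarith
    rw [h3]
    nlinarith
  · by_contra h
    refine hφ ?_
    have : cutoff b C φ = 0 := by
      by_contra h1
      exact h (wSq_lt_of_cutoff_ne_zero b C h1).le
    simp [priorDens, this]

end prior

/-! ### The minimax lower bound -/

/-- The prior with unit Fisher information for weights that may vanish: the weights are enlarged by
a small constant, at the price of one more multiple of `(∑ bᵢ²)^{1/2}`. -/
lemma exists_isUnitFisherDensity_of_nonneg {n : ℕ} (hn : 0 < n) {b : Fin n → ℝ} {C : ℝ}
    (hb : ∀ i, 0 ≤ b i)
    (hC : ∑ i, b i + (1 + 16 * (gaussFourth + 1) + 1) * √(∑ i, b i ^ 2) ≤ C) :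
    ∃ ρ L, IsUnitFisherDensity (n := n) ρ L ∧ ∀ φ, ρ φ ≠ 0 → wSq b φ ≤ C := by
  set N := √(∑ i, b i ^ 2) with hN
  have hs0 : 0 ≤ ∑ i, b i ^ 2 := Finset.sum_nonneg fun _ _ => sq_nonneg _
  have hM := gaussFourth_nonneg
  set B := 1 + 16 * (gaussFourth + 1) with hB
  have hB0 : 0 < B := by positivity
  have hn' : (0 : ℝ) < n := by exact_mod_cast hn
  rcases (Real.sqrt_nonneg _ : 0 ≤ N).eq_or_lt with h0 | hN0
  · have hz : ∑ i, b i ^ 2 = 0 := (Real.sqrt_eq_zero hs0).1 h0.symm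
    have hbz (i : Fin n) : b i = 0 := by
      have := (Finset.sum_eq_zero_iff_of_nonneg fun _ _ => sq_nonneg _).1 hz i (Finset.mem_univ i)
      exact pow_eq_zero_iff two_ne_zero |>.1 this
    obtain ⟨ρ, L, h, -⟩ := exists_isUnitFisherDensity (b := fun _ : Fin n => (1 : ℝ)) hn
      (fun _ => one_pos) le_rfl
    refine ⟨ρ, L, h, fun φ _ => ?_⟩
    rw [hN.trans h0.symm] at hC
    simpa [wSq, hbz] using hC
  · have hNsq : N ^ 2 = ∑ i, b i ^ 2 := Real.sq_sqrt hs0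
    set ε := N / (n + B * √n) with hε
    have hd : 0 < n + B * √n := by positivity
    have hε0 : 0 < ε := div_pos hN0 hd
    have hεe : ε * (n + B * √n) = N := div_mul_cancel₀ _ hd.ne'
    have hcs : ∑ i, b i ≤ √n * N := by
      rw [hN, ← Real.sqrt_mul hn'.le]
      refine Real.le_sqrt_of_sq_le ?_
      simpa using sq_sum_le_card_mul_sum_sq (s := Finset.univ) (f := b)
    have hnorm : √(∑ i, (b i + ε) ^ 2) ≤ N + ε * √n := by
      refine Real.sqrt_le_iff.2 ⟨by positivity, ?_⟩
      have h1 : ∑ i, (b i + ε) ^ 2 = N ^ 2 + 2 * ε * ∑ i, b i + n * ε ^ 2 := by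
        simp_rw [add_sq]
        rw [Finset.sum_add_distrib, Finset.sum_add_distrib, hNsq, Finset.mul_sum]
        simp only [Finset.sum_const, Finset.card_univ, Fintype.card_fin, nsmul_eq_mul]
        congr 2
        exact Finset.sum_congr rfl fun i _ => by ring
      have h2 : √(n : ℝ) ^ 2 = n := Real.sq_sqrt hn'.le
      rw [h1]
      nlinarith [mul_le_mul_of_nonneg_left hcs hε0.le]
    obtain ⟨ρ, L, h, hsupp⟩ := exists_isUnitFisherDensity (b := fun i => b i + ε) (C := C) hn
      (fun i => add_pos_of_nonneg_of_pos (hb i) hε0) (by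
        rw [Finset.sum_add_distrib]
        simp only [Finset.sum_const, Finset.card_univ, Fintype.card_fin, nsmul_eq_mul]
        nlinarith [mul_le_mul_of_nonneg_left hnorm hB0.le])
    refine ⟨ρ, L, h, fun φ hφ => le_trans ?_ (hsupp φ hφ)⟩
    exact Finset.sum_le_sum fun i _ => mul_le_mul_of_nonneg_right (by linarith) (sq_nonneg _)

/-- The Bayes risk of a prior is a lower bound of the maximal risk over any set that carries it. -/
lemma ofReal_le_iSup_klRisk {n m : ℕ} (hn : 0 < n) (hm : 0 < m) {ρ : (Fin n → ℝ) → ℝ}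
    {L : Fin n → (Fin n → ℝ) → ℝ} (hρ : IsUnitFisherDensity ρ L) (s : Fin n → ℝ)
    {Θ : Set (Fin n → ℝ)} (hΘ : ∀ φ, ρ φ ≠ 0 → s * φ ∈ Θ) (p : PredictiveDensity n) :
    ENNReal.ofReal ((n : ℝ) / (2 * m) * Real.log ((noiseVar n : ℝ) / noiseVar (n + m)) +
      1 / (2 * (m : ℝ)) * ∑ i : Fin n,
        Real.log (((noiseVar (n + m) : ℝ) + s i ^ 2) / ((noiseVar n : ℝ) + s i ^ 2))) ≤
      ⨆ θ ∈ Θ, klRisk m θ p := by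
  have := hρ.isProbabilityMeasure
  have hn' : (0 : ℝ) < n := by exact_mod_cast hn
  have hm' : (0 : ℝ) < m := by exact_mod_cast hm
  have hwe : (noiseVar n : ℝ) = 1 / n := by simp [noiseVar]
  have hve : (noiseVar m : ℝ) = 1 / m := by simp [noiseVar]
  have hue : (noiseVar (n + m) : ℝ) = 1 / (n + m) := by simp [noiseVar]
  have hw : noiseVar n ≠ 0 := by simp [noiseVar, hn.ne']
  have hv : noiseVar m ≠ 0 := by simp [noiseVar, hm.ne']
  have hθ : Measurable fun φ : Fin n → ℝ => s * φ := by fun_prop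
  obtain ⟨R, hR⟩ := hρ.exists_ae_norm_le s
  have h1 := ofReal_le_lintegral_klDiv hθ hR hw hv p
  have hu : noiseVar n * noiseVar m / (noiseVar n + noiseVar m) = noiseVar (n + m) := by
    rw [← NNReal.coe_inj]
    push_cast
    rw [hwe, hve, hue]
    field_simp
    ring
  have hlog : ((noiseVar n : ℝ) + noiseVar m) / noiseVar m = noiseVar n / noiseVar (n + m) := by
    rw [hwe, hve, hue]
    field_simp
    ring
  have hu0 : (0 : ℝ) < noiseVar (n + m) := by rw [hue]; positivity
  have huw : (noiseVar (n + m) : ℝ) ≤ noiseVar n := by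
    rw [hue, hwe]
    exact one_div_le_one_div_of_le hn' (by linarith)
  have h2 := meanLog_sub_meanLog_le (π := densMeasure ρ) hθ hR hu0 huw s
    (fun v hv => hρ.le_bayesMSE hv s)
  have hu' : (noiseVar n : ℝ) * noiseVar m / (noiseVar n + noiseVar m) = noiseVar (n + m) := by
    exact_mod_cast congrArg NNReal.toReal hu
  rw [hlog, hu'] at h1
  have hrisk : ∫⁻ φ, klRisk m (s * φ) p ∂(densMeasure ρ) ≤ ⨆ θ ∈ Θ, klRisk m θ p := by
    calc ∫⁻ φ, klRisk m (s * φ) p ∂(densMeasure ρ)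
        ≤ ∫⁻ _, (⨆ θ ∈ Θ, klRisk m θ p) ∂(densMeasure ρ) := by
          refine lintegral_mono_ae ?_
          filter_upwards [hρ.ae_ne_zero] with φ hφ
          exact le_iSup₂ (f := fun θ (_ : θ ∈ Θ) => klRisk m θ p) (s * φ) (hΘ φ hφ)
      _ = _ := by simp
  refine le_trans ?_ hrisk
  have hmE : (m : ℝ≥0∞)⁻¹ = ENNReal.ofReal (m : ℝ)⁻¹ := by
    rw [ENNReal.ofReal_inv_of_pos hm', ENNReal.ofReal_natCast]
  unfold klRisk
  rw [lintegral_const_mul' _ _ (by simp [hm.ne'])]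
  refine le_trans ?_ (mul_le_mul_right h1 _)
  rw [hmE, ← ENNReal.ofReal_mul (by positivity)]
  refine ENNReal.ofReal_le_ofReal ?_
  have h3 : ∑ i, Real.log (((noiseVar (n + m) : ℝ) + s i ^ 2) / ((noiseVar n : ℝ) + s i ^ 2)) =
      -∑ i, Real.log (((noiseVar n : ℝ) + s i ^ 2) / ((noiseVar (n + m) : ℝ) + s i ^ 2)) := by
    rw [← Finset.sum_neg_distrib]
    exact Finset.sum_congr rfl fun i _ => by rw [← Real.log_inv, inv_div]
  rw [h3]
  set A := ∑ i, Real.log (((noiseVar n : ℝ) + s i ^ 2) / ((noiseVar (n + m) : ℝ) + s i ^ 2))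
  set l := Real.log ((noiseVar n : ℝ) / noiseVar (n + m))
  calc (n : ℝ) / (2 * m) * l + 1 / (2 * m) * -A = (m : ℝ)⁻¹ * (n / 2 * l - 1 / 2 * A) := by
        field_simp
        ring
    _ ≤ _ := mul_le_mul_of_nonneg_left (by linarith) (by positivity)

lemma mul_log_noiseVar_div_le {n m : ℕ} (hn : 0 < n) (hm : 0 < m) :
    (n : ℝ) / (2 * m) * Real.log ((noiseVar n : ℝ) / noiseVar (n + m)) ≤ 1 / 2 := by
  have hn' : (0 : ℝ) < n := by exact_mod_cast hn
  have hm' : (0 : ℝ) < m := by exact_mod_cast hm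
  have h1 : (noiseVar n : ℝ) / noiseVar (n + m) = (n + m) / n := by simp [noiseVar]; field_simp
  have h2 : Real.log (((n : ℝ) + m) / n) ≤ m / n := by
    refine (Real.log_le_sub_one_of_pos (by positivity)).trans (le_of_eq ?_)
    field_simp
    ring
  rw [h1]
  calc (n : ℝ) / (2 * m) * Real.log ((n + m) / n) ≤ n / (2 * m) * (m / n) :=
        mul_le_mul_of_nonneg_left h2 (by positivity)
    _ = 1 / 2 := by field_simp

lemma sum_log_noiseVar_add_div_nonpos {n m : ℕ} (hn : 0 < n) (s : Fin n → ℝ) :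
    ∑ i : Fin n,
      Real.log (((noiseVar (n + m) : ℝ) + s i ^ 2) / ((noiseVar n : ℝ) + s i ^ 2)) ≤ 0 := by
  have hn' : (0 : ℝ) < n := by exact_mod_cast hn
  have h : (noiseVar (n + m) : ℝ) ≤ noiseVar n := by
    simp only [noiseVar]
    push_cast
    exact one_div_le_one_div_of_le hn' (by simp)
  refine Finset.sum_nonpos fun i _ => Real.log_nonpos (by positivity) ?_
  exact div_le_one_of_le₀ (by linarith) (by positivity)

theorem lemma4p1 (a : ℕ → ℝ) (ha : Monotone a) (ha_top : Tendsto a atTop atTop)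
    (C α : ℝ) (hα : 0 < α) :
    ∃ K : ℝ, ∀ n m : ℕ, 0 < n → 0 < m → ∀ s : Fin n → ℝ,
      ∑ i : Fin n, a i ^ 2 * s i ^ 2 +
          Real.sqrt (-8 * α * (∑ i : Fin n, a i ^ 4 * s i ^ 4) * Real.log (noiseVar n)) ≤ C →
      (((n : ℝ) / (2 * m) * Real.log ((noiseVar n : ℝ) / noiseVar (n + m)) +
          1 / (2 * (m : ℝ)) * ∑ i : Fin n,
            Real.log (((noiseVar (n + m) : ℝ) + s i ^ 2) / ((noiseVar n : ℝ) + s i ^ 2)) -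
          K * (noiseVar n : ℝ) ^ α : ℝ) : EReal) ≤
        (klMinimaxRisk m (ellipsoid a C n) : EReal) := by
  set B := 1 + 16 * (gaussFourth + 1) + 1 with hB
  have hM := gaussFourth_nonneg
  have hB0 : 0 < B := by positivity
  obtain ⟨n₀, hn₀⟩ := exists_nat_ge (Real.exp (B ^ 2 / (8 * α)))
  have hn₀pos : (0 : ℝ) < n₀ := (Real.exp_pos _).trans_le hn₀
  refine ⟨1 / 2 * (n₀ : ℝ) ^ α, fun n m hn hm s hs => ?_⟩
  have hn' : (0 : ℝ) < n := by exact_mod_cast hn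
  have hwe : (noiseVar n : ℝ) = (n : ℝ)⁻¹ := by simp [noiseVar]
  set T := (n : ℝ) / (2 * m) * Real.log ((noiseVar n : ℝ) / noiseVar (n + m)) +
    1 / (2 * (m : ℝ)) * ∑ i : Fin n,
      Real.log (((noiseVar (n + m) : ℝ) + s i ^ 2) / ((noiseVar n : ℝ) + s i ^ 2)) with hT
  rcases lt_or_ge n n₀ with hlt | hge
  · -- for the finitely many small `n` the main term is at most `1 / 2`
    have h1 : T ≤ 1 / 2 := by
      have := mul_nonpos_of_nonneg_of_nonpos (show (0 : ℝ) ≤ 1 / (2 * (m : ℝ)) by positivity)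
        (sum_log_noiseVar_add_div_nonpos (m := m) hn s)
      linarith [mul_log_noiseVar_div_le hn hm]
    have h2 : 1 ≤ (n₀ : ℝ) ^ α * (noiseVar n : ℝ) ^ α := by
      rw [← Real.mul_rpow hn₀pos.le (by positivity), hwe]
      refine Real.one_le_rpow ?_ hα.le
      rw [← div_eq_mul_inv, one_le_div hn']
      exact_mod_cast hlt.le
    have h3 : T - 1 / 2 * (n₀ : ℝ) ^ α * (noiseVar n : ℝ) ^ α ≤ 0 := by
      rw [mul_assoc]; linarith
    calc ((T - 1 / 2 * (n₀ : ℝ) ^ α * (noiseVar n : ℝ) ^ α : ℝ) : EReal) ≤ 0 := by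
          exact_mod_cast h3
      _ ≤ _ := EReal.coe_ennreal_nonneg _
  · -- for large `n` the slack in the constraint leaves room for a prior with unit Fisher
    -- information inside the ellipsoid
    set b : Fin n → ℝ := fun i => a i ^ 2 * s i ^ 2 with hb
    have hC : ∑ i, b i + B * √(∑ i, b i ^ 2) ≤ C := by
      refine le_trans ?_ hs
      have h1 : B ^ 2 ≤ 8 * α * Real.log n := by
        have h2 : B ^ 2 / (8 * α) ≤ Real.log n :=
          (Real.le_log_iff_exp_le hn').2 (hn₀.trans (by exact_mod_cast hge))
        rwa [div_le_iff₀' (by positivity)] at h2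
      have h3 : -8 * α * (∑ i : Fin n, a i ^ 4 * s i ^ 4) * Real.log (noiseVar n) =
          8 * α * Real.log n * ∑ i, b i ^ 2 := by
        rw [hwe, Real.log_inv, show ∑ i : Fin n, a i ^ 4 * s i ^ 4 = ∑ i, b i ^ 2 from
          Finset.sum_congr rfl fun i _ => by simp only [hb]; ring]
        ring
      have h4 : B ≤ √(8 * α * Real.log n) := Real.le_sqrt_of_sq_le h1
      rw [h3, Real.sqrt_mul ((sq_nonneg _).trans h1)]
      gcongr
    obtain ⟨ρ, L, hρ, hsupp⟩ :=
      exists_isUnitFisherDensity_of_nonneg hn (fun i => by positivity) hC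
    have hΘ : ∀ φ, ρ φ ≠ 0 → s * φ ∈ ellipsoid a C n := fun φ hφ => by
      have h := hsupp φ hφ
      simp only [wSq, hb] at h
      simpa only [ellipsoid, Set.mem_ofPred_eq, Pi.mul_apply, mul_pow, mul_assoc] using h
    have h1 : ENNReal.ofReal T ≤ klMinimaxRisk m (ellipsoid a C n) :=
      le_iInf fun p => ofReal_le_iSup_klRisk hn hm hρ s hΘ p
    have h2 : T - 1 / 2 * (n₀ : ℝ) ^ α * (noiseVar n : ℝ) ^ α ≤ T := by
      have : 0 ≤ 1 / 2 * (n₀ : ℝ) ^ α * (noiseVar n : ℝ) ^ α := by positivity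
      linarith
    calc ((T - 1 / 2 * (n₀ : ℝ) ^ α * (noiseVar n : ℝ) ^ α : ℝ) : EReal)
        ≤ ((max T 0 : ℝ) : EReal) := by exact_mod_cast h2.trans (le_max_left _ _)
      _ = (ENNReal.ofReal T : EReal) := (EReal.coe_ennreal_ofReal).symm
      _ ≤ _ := by exact_mod_cast h1
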